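/- A polygonal domain is a compact simply connected set $P\subset\mathbb R^2$ whose boundary is a simple closed polygon: there are $m\ge 3$ distinct nodes $z_1,\dots,z_m$ (indices modulo $m$) such that $\partial P=E(1)\cup\dots\cup E(m)$ for the edges $E(j)=\operatorname{conv}\{z_j,z_{j+1}\}$, consecutive edges meet only in their common node, and non-consecutive edges are disjoint. Let $h_P$ be the diameter of $P$, let $H^1(P):=H^1(\operatorname{int}P)$, and let $|f|_{1,P}=\|\nabla f\|_{L^2(P)}$. We say that $P$ satisfies the Poincaré–Friedrichs inequality with constant $C$ if $$\|f\|_{L^2(P)}\le C\,h_P\,|f|_{1,P}$$ for every $f\in H^1(P)$ with $\sum_{j\in J}\int_{E(j)}f\,ds=0$ (in the sense of traces) for some nonempty $J\subseteq\{1,\dots,m\}$. (a) For every $\rho>0$ there is a constant $C_{\rm PF}>0$, depending only on $\rho$, such that the Poincaré–Friedrichs inequality with constant $C_{\rm PF}$ holds on every polygonal domain $P$ that is star-shaped with respect to every point of some ball of radius at least $\rho h_P$ and all of whose edges have length at least $\rho h_P$. (b) Let $P$ be a polygonal domain with $m$ edges and let $c\in\operatorname{int}P$ be such that the (non-degenerate)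 triangles $T(j)=\operatorname{conv}\{c,z_j,z_{j+1}\}$, $j=1,\dots,m$, form a regular triangulation of $P$; let $t_{\max}$ and $t_{\min}$ be the maximal and minimal area of these triangles. Then the Poincaré–Friedrichs inequality holds on $P$ with the constant $C_{\rm PF}>0$ given by $$C_{\rm PF}^2=\Big(M+\frac14\Big)\frac{t_{\max}}{t_{\min}}+C_{\rm P}^2,\qquad M=\frac{1}{2(1-\cos(\pi/m))},\qquad C_{\rm P}=\frac1{j_{1,1}},$$ where $j_{1,1}\approx 3.8317$ is the first positive root of the Bessel function $J_1$. In particular, the constant depends only on $m$ and on $t_{\max}/t_{\min}$. -/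

import Mathlib

open MeasureTheory Filter Topology
open scoped ContDiff

noncomputable section

/-- The Euclidean plane. -/
abbrev Plane : Type := EuclideanSpace ℝ (Fin 2)

/-! ### Polygonal domains -/

/-- The edge `E(j) = conv {z_j, z_{j+1}}`; indices are cyclic (addition in `Fin m` wraps around). -/
def polyEdge {m : ℕ} [NeZero m] (z : Fin m → Plane) (j : Fin m) : Set Plane :=
  segment ℝ (z j) (z (j + 1))

/-- `P` is a polygonal domain with the consecutive nodes `z_0, …, z_{m-1}`: a compact simply
connected set whose boundary is the simple closed polygon through the distinct points `z_j`.
Edges are compact, so disjointness of two edges is the same as having positive distance. The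
interior of such a set is automatically a Lipschitz domain. -/
structure IsPolygonalDomain {m : ℕ} [NeZero m] (P : Set Plane) (z : Fin m → Plane) : Prop where
  three_le : 3 ≤ m
  isCompact : IsCompact P
  simplyConnected : SimplyConnectedSpace P
  injective : Function.Injective z
  frontier_eq : frontier P = ⋃ j, polyEdge z j
  consecutive : ∀ j, polyEdge z j ∩ polyEdge z (j + 1) = {z (j + 1)}
  nonconsecutive : ∀ j k, j ≠ k → k ≠ j + 1 → j ≠ k + 1 → Disjoint (polyEdge z j) (polyEdge z k)

/-- Mesh regularity with parameter `ρ`: `P` is star-shaped with respect to every point of some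
ball of radius at least `ρ h_P`, and every edge has length at least `ρ h_P`, where `h_P` is the
diameter of `P`. -/
def IsMeshRegular {m : ℕ} [NeZero m] (ρ : ℝ) (P : Set Plane) (z : Fin m → Plane) : Prop :=
  (∃ (c : Plane) (r : ℝ), ρ * Metric.diam P ≤ r ∧ ∀ x ∈ Metric.ball c r, StarConvex ℝ x P) ∧
    ∀ j, ρ * Metric.diam P ≤ dist (z j) (z (j + 1))

/-- The vertices of the triangle `T(j) = conv {c, z_j, z_{j+1}}`. -/
def subVertices {m : ℕ} [NeZero m] (z : Fin m → Plane) (c : Plane) (j : Fin m) : Set Plane :=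
  {c, z j, z (j + 1)}

/-- The triangle `T(j) = conv {c, z_j, z_{j+1}}`. -/
def subTriangle {m : ℕ} [NeZero m] (z : Fin m → Plane) (c : Plane) (j : Fin m) : Set Plane :=
  convexHull ℝ (subVertices z c j)

/-- The triangles `T(j) = conv {c, z_j, z_{j+1}}` form a (regular) triangulation of `P` with the
interior node `c`: they are non-degenerate, they cover exactly `P`, and two different triangles
meet exactly in the simplex spanned by their common vertices. -/
structure IsSubtriangulation {m : ℕ} [NeZero m] (P : Set Plane) (z : Fin m → Plane)
    (c : Plane) : Prop where
  interior_node : c ∈ interior P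
  nondegenerate : ∀ j, AffineIndependent ℝ ![c, z j, z (j + 1)]
  cover : P = ⋃ j, subTriangle z c j
  inter : ∀ j k, j ≠ k → subTriangle z c j ∩ subTriangle z c k =
    convexHull ℝ (subVertices z c j ∩ subVertices z c k)

/-- The minimal area `t_min` of a triangle of the sub-triangulation. -/
def minArea {m : ℕ} [NeZero m] (z : Fin m → Plane) (c : Plane) : ℝ :=
  Finset.univ.inf' Finset.univ_nonempty fun j => volume.real (subTriangle z c j)

/-- The maximal area `t_max` of a triangle of the sub-triangulation. -/
def maxArea {m : ℕ} [NeZero m] (z : Fin m → Plane) (c : Plane) : ℝ :=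
  Finset.univ.sup' Finset.univ_nonempty fun j => volume.real (subTriangle z c j)

/-! ### Sobolev functions and traces -/

/-- `f ∈ H¹(U)` with weak gradient `G`. -/
structure IsH1WithGradient (U : Set Plane) (f : Plane → ℝ) (G : Plane → Plane) : Prop where
  memLp : MemLp f 2 (volume.restrict U)
  memLp_grad : MemLp G 2 (volume.restrict U)
  weak : ∀ φ : Plane → ℝ, ContDiff ℝ ∞ φ → HasCompactSupport φ → tsupport φ ⊆ U →
    ∫ x in U, f x • gradient φ x = - ∫ x in U, φ x • G x

/-- The norm of `L²(U)` (of scalar or vector fields). -/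
def l2Norm {F : Type*} [NormedAddCommGroup F] (U : Set Plane) (f : Plane → F) : ℝ :=
  (eLpNorm f 2 (volume.restrict U)).toReal

/-- The line integral `∫_{E(j)} g ds` in the constant speed parametrization of the edge. -/
def edgeIntegral {m : ℕ} [NeZero m] (z : Fin m → Plane) (j : Fin m) (g : Plane → ℝ) : ℝ :=
  dist (z j) (z (j + 1)) * ∫ t in (0 : ℝ)..1, g (AffineMap.lineMap (z j) (z (j + 1)) t)

/-- `g` is the trace on `∂P` of the Sobolev function `f ∈ H¹(int P)` with weak gradient `G`. The
trace operator is the continuous extension to `H¹(int P)` of the restriction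
`φ ↦ φ|_{∂P}` of smooth functions: `g ∈ L²(∂P)` is the limit in `L²(∂P)`, that is, in `L²(E(j))`
for every edge, of the restrictions of functions `φ_n`, smooth up to the boundary, that converge
to `f` in `H¹(int P)`. -/
def IsTrace {m : ℕ} [NeZero m] (P : Set Plane) (z : Fin m → Plane)
    (f : Plane → ℝ) (G : Plane → Plane) (g : Plane → ℝ) : Prop :=
  (∀ j, MemLp (fun t : ℝ => g (AffineMap.lineMap (z j) (z (j + 1)) t)) 2
    (volume.restrict (Set.Icc 0 1))) ∧
  ∃ φ : ℕ → Plane → ℝ, (∀ n, ContDiff ℝ ∞ (φ n)) ∧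
    Tendsto (fun n => eLpNorm (fun x => φ n x - f x) 2 (volume.restrict (interior P)))
      atTop (𝓝 0) ∧
    Tendsto (fun n => eLpNorm (fun x => gradient (φ n) x - G x) 2
      (volume.restrict (interior P))) atTop (𝓝 0) ∧
    ∀ j, Tendsto (fun n => eLpNorm (fun t : ℝ =>
        φ n (AffineMap.lineMap (z j) (z (j + 1)) t) - g (AffineMap.lineMap (z j) (z (j + 1)) t)) 2
      (volume.restrict (Set.Icc 0 1))) atTop (𝓝 0)

/-- The Poincaré–Friedrichs inequality on `P` with the constant `C`:
`‖f‖_{L²(P)} ≤ C h_P |f|_{1,P}` for every `f ∈ H¹(P)` (with weak gradient `G` and trace `g`) whose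
integral over the union of the edges `E(j)`, `j ∈ J`, vanishes for some non-empty `J`. -/
def PoincareFriedrichs {m : ℕ} [NeZero m] (P : Set Plane) (z : Fin m → Plane) (C : ℝ) : Prop :=
  ∀ (f : Plane → ℝ) (G : Plane → Plane) (g : Plane → ℝ),
    IsH1WithGradient (interior P) f G → IsTrace P z f G g →
    ∀ J : Finset (Fin m), J.Nonempty → ∑ j ∈ J, edgeIntegral z j g = 0 →
      l2Norm (interior P) f ≤ C * Metric.diam P * l2Norm (interior P) G

/-! ### The explicit constant -/

/-- The Bessel function `J₁` of the first kind. -/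
def besselJOne (x : ℝ) : ℝ :=
  ∑' k : ℕ, (-1) ^ k / ((k.factorial : ℝ) * ((k + 1).factorial : ℝ)) * (x / 2) ^ (2 * k + 1)

/-- The first positive root `j_{1,1} ≈ 3.8317` of `J₁`. -/
def besselRoot : ℝ := sInf {x : ℝ | 0 < x ∧ besselJOne x = 0}

/-- `C_PF`, given by `C_PF² = (M + 1/4) q + C_P²`, `M = 1 / (2 (1 - cos (π / m)))`,
`C_P = 1 / j_{1,1}`, as a function of the number `m` of edges and of the quotient
`q = t_max / t_min`. -/
def constPF (m : ℕ) (q : ℝ) : ℝ :=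
  Real.sqrt ((1 / (2 * (1 - Real.cos (Real.pi / m))) + 1 / 4) * q + (1 / besselRoot) ^ 2)

end

noncomputable section

/-! ### One-dimensional inequalities -/

/-! Everything reduces to one estimate for a `C¹` function and one edge: the squared `L²(P)`
distance of `φ` from its mean over `E(i)` is at most `(C h_P)²` times the energy `∫ |∇φ|²`. This
passes to `f ∈ H¹` by approximation, where the trace supplies convergence of the edge means. If the
edge integrals over `J` sum to zero, then `f` is the average of the functions `f - a_j`, where `a_j`
is the mean of the trace over `E(j)`, weighted by the edge lengths. The triangle inequality then
gives the claim for every `J` with the same constant (`poincareFriedrichs_of_contDiff`).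

For (b), let `a` be the mean over `E(i)` and `b_j` the mean over the spoke from `c` to `z_j`.
Polar-type coordinates at a vertex reduce three triangle estimates to one-dimensional inequalities:
the deviation from the mean over one side is controlled by the energy (`triangle_friedrichs`), so is
the deviation from any other constant up to the gap between the two constants
(`triangle_integral_sub_const_sq_le`), and the means over two sides of a triangle differ by little
(`triangle_segMean_sub_sq_le`). Hence `b_j - a` is bounded by adding increments along the shorter
way around `c` from `T(i)`. Summing the squared bounds (`cycle_sum_le`) produces the factor `3/8 +
(7/20)⌊m²/4⌋`, which `constant_le_cos` compares with `M + 1/4`. The term `C_P²` is then pure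
surplus.

For (a), integration along segments joining points of `P` to points of the ball compares `φ` with
its mean `β` over the ball (`exists_integral_sub_sq_le_of_segment_subset`). The triangle spanned by
the centre and `E(i)` lies in `P` and has area at least a fixed fraction of `h_P²`, because the line
through an edge cannot enter the ball. On this triangle `φ` is close both to `a` and to `β`, which
bounds `a - β`. -/

theorem sq_integral_le_mul_integral {α : Type*} [MeasurableSpace α] {μ : Measure α}
    {u v w : α → ℝ} (hu : Integrable u μ) (hv : Integrable v μ) (hw : Integrable w μ)
    (hu0 : ∀ᵐ a ∂μ, 0 ≤ u a) (hv0 : ∀ᵐ a ∂μ, 0 ≤ v a) (h : ∀ᵐ a ∂μ, w a ^ 2 ≤ u a * v a) :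
    (∫ a, w a ∂μ) ^ 2 ≤ (∫ a, u a ∂μ) * ∫ a, v a ∂μ := by
  -- The integrand is pointwise nonnegative because `w² ≤ u v`, so this quadratic in `x` has
  -- nonpositive discriminant.
  have key : ∀ x : ℝ, 0 ≤ (∫ a, v a ∂μ) * (x * x) + (2 * ∫ a, w a ∂μ) * x + ∫ a, u a ∂μ := by
    intro x
    have e : (∫ a, v a ∂μ) * (x * x) + (2 * ∫ a, w a ∂μ) * x + ∫ a, u a ∂μ
        = ∫ a, (v a * (x * x) + w a * (2 * x) + u a) ∂μ := by
      rw [integral_add _ hu, integral_add (hv.mul_const _) (hw.mul_const _),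
        integral_mul_const, integral_mul_const]
      · ring
      · exact (hv.mul_const _).add (hw.mul_const _)
    rw [e]
    apply integral_nonneg_of_ae
    filter_upwards [hu0, hv0, h] with a h1 h2 h3
    simp only [Pi.zero_apply]
    rcases h2.eq_or_lt with h4 | h4
    · have : w a = 0 := by
        rw [← h4, mul_zero] at h3
        exact pow_eq_zero_iff two_ne_zero |>.1 (le_antisymm h3 (sq_nonneg _))
      rw [← h4, this]; simpa using h1
    · have : 0 ≤ v a * (v a * (x * x) + w a * (2 * x) + u a) := by
        nlinarith [sq_nonneg (v a * x + w a)]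
      exact nonneg_of_mul_nonneg_right this h4
  have := discrim_le_zero key
  rw [discrim] at this
  nlinarith

theorem ContDiff.hasDerivAt_deriv {f : ℝ → ℝ} (hf : ContDiff ℝ 1 f) (x : ℝ) :
    HasDerivAt f (deriv f x) x :=
  (hf.differentiable (by norm_num) x).hasDerivAt

theorem sq_sub_le_sub_mul_integral {f : ℝ → ℝ} (hf : ContDiff ℝ 1 f) {a b : ℝ} (hab : a ≤ b) :
    (f b - f a) ^ 2 ≤ (b - a) * ∫ x in a..b, deriv f x ^ 2 := by
  have hc : Continuous (deriv f) := hf.continuous_deriv le_rfl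
  rw [← intervalIntegral.integral_deriv_eq_sub' f rfl
    (fun x _ => hf.differentiable (by norm_num) x) hc.continuousOn]
  have e : b - a = ∫ _ in a..b, (1 : ℝ) := by simp
  rw [e, intervalIntegral.integral_of_le hab, intervalIntegral.integral_of_le hab,
    intervalIntegral.integral_of_le hab]
  apply sq_integral_le_mul_integral
  · exact integrable_const _
  · exact (hc.pow 2).integrableOn_Ioc
  · exact hc.integrableOn_Ioc
  · simp
  · exact ae_of_all _ fun x => sq_nonneg _
  · simp

/-- Poincaré inequality on the unit interval, with the value at the midpoint. -/
theorem integral_sq_sub_midpoint_le {f : ℝ → ℝ} (hf : ContDiff ℝ 1 f) :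
    ∫ x in (0 : ℝ)..1, (f x - f (1 / 2)) ^ 2 ≤ 1 / 8 * ∫ x in (0 : ℝ)..1, deriv f x ^ 2 := by
  have hc : Continuous (deriv f) := hf.continuous_deriv le_rfl
  have hf0 : Continuous f := hf.continuous
  have hi : ∀ a b, IntervalIntegrable (fun x => (f x - f (1 / 2)) ^ 2) volume a b := fun a b =>
    ((hf0.sub continuous_const).pow 2).intervalIntegrable a b
  have hd : ∀ a b, IntervalIntegrable (fun x => deriv f x ^ 2) volume a b := fun a b =>
    (hc.pow 2).intervalIntegrable a b
  rw [← intervalIntegral.integral_add_adjacent_intervals (hi 0 (1 / 2)) (hi (1 / 2) 1),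
    ← intervalIntegral.integral_add_adjacent_intervals (hd 0 (1 / 2)) (hd (1 / 2) 1)]
  have h1 : ∫ x in (0 : ℝ)..1 / 2, (f x - f (1 / 2)) ^ 2
      ≤ ∫ x in (0 : ℝ)..1 / 2, (1 / 2 - x) * ∫ y in (0 : ℝ)..1 / 2, deriv f y ^ 2 := by
    apply intervalIntegral.integral_mono_on (by norm_num) (hi _ _)
      (Continuous.intervalIntegrable (by fun_prop) _ _)
    intro x hx
    rw [← neg_sq, neg_sub]
    refine (sq_sub_le_sub_mul_integral hf hx.2).trans ?_
    refine mul_le_mul_of_nonneg_left ?_ (by linarith [hx.2])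
    exact intervalIntegral.integral_mono_interval hx.1 hx.2 le_rfl
      (ae_of_all _ fun x => sq_nonneg _) (hd _ _)
  have h2 : ∫ x in (1 / 2 : ℝ)..1, (f x - f (1 / 2)) ^ 2
      ≤ ∫ x in (1 / 2 : ℝ)..1, (x - 1 / 2) * ∫ y in (1 / 2 : ℝ)..1, deriv f y ^ 2 := by
    apply intervalIntegral.integral_mono_on (by norm_num) (hi _ _)
      (Continuous.intervalIntegrable (by fun_prop) _ _)
    intro x hx
    refine (sq_sub_le_sub_mul_integral hf hx.1).trans ?_
    refine mul_le_mul_of_nonneg_left ?_ (by linarith [hx.1])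
    exact intervalIntegral.integral_mono_interval le_rfl hx.1 hx.2
      (ae_of_all _ fun x => sq_nonneg _) (hd _ _)
  rw [intervalIntegral.integral_mul_const] at h1 h2
  have e1 : ∫ x in (0 : ℝ)..1 / 2, (1 / 2 - x) = 1 / 8 := by
    rw [intervalIntegral.integral_sub (by simp) (by simp)]; simp; norm_num
  have e2 : ∫ x in (1 / 2 : ℝ)..1, (x - 1 / 2) = 1 / 8 := by
    rw [intervalIntegral.integral_sub (by simp) (by simp)]; simp; norm_num
  rw [e1] at h1
  rw [e2] at h2
  linarith

theorem integral_sub_const_sq {f : ℝ → ℝ} (hf : Continuous f) (b : ℝ) :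
    ∫ x in (0 : ℝ)..1, (f x - b) ^ 2
      = (∫ x in (0 : ℝ)..1, (f x - ∫ y in (0 : ℝ)..1, f y) ^ 2)
        + ((∫ y in (0 : ℝ)..1, f y) - b) ^ 2 := by
  have h : ∀ c : ℝ, ∫ x in (0 : ℝ)..1, (f x - c) ^ 2
      = (∫ x in (0 : ℝ)..1, f x ^ 2) - 2 * c * (∫ x in (0 : ℝ)..1, f x) + c ^ 2 := by
    intro c
    have : ∀ x, (f x - c) ^ 2 = f x ^ 2 - 2 * c * f x + c ^ 2 := fun x => by ring
    simp_rw [this]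
    rw [intervalIntegral.integral_add, intervalIntegral.integral_sub,
      intervalIntegral.integral_const_mul]
    · simp
    all_goals exact Continuous.intervalIntegrable (by fun_prop) _ _
  rw [h, h]; ring

/-- Poincaré inequality on the unit interval. -/
theorem integral_sq_sub_mean_le {f : ℝ → ℝ} (hf : ContDiff ℝ 1 f) :
    ∫ x in (0 : ℝ)..1, (f x - ∫ y in (0 : ℝ)..1, f y) ^ 2
      ≤ 1 / 8 * ∫ x in (0 : ℝ)..1, deriv f x ^ 2 := by
  have h := integral_sq_sub_midpoint_le hf
  -- The mean minimizes the quadratic deviation, so the bound with the midpoint value carries over.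
  rw [integral_sub_const_sq hf.continuous] at h
  nlinarith [sq_nonneg ((∫ y in (0 : ℝ)..1, f y) - f (1 / 2))]

/-- Cauchy–Schwarz for `f' = x^(-1/2) · x^(1/2) f'`, with `∫_s^1 dx/x = -log s`. The weight `x` is
the Jacobian factor of the triangle parametrization below. -/
theorem sq_sub_one_le_neg_log_mul {f : ℝ → ℝ} (hf : ContDiff ℝ 1 f) {s : ℝ} (h0 : 0 < s)
    (h1 : s ≤ 1) :
    (f s - f 1) ^ 2 ≤ (-Real.log s) * ∫ x in (0 : ℝ)..1, x * deriv f x ^ 2 := by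
  have hc : Continuous (deriv f) := hf.continuous_deriv le_rfl
  have hd : ∀ a b, IntervalIntegrable (fun x => x * deriv f x ^ 2) volume a b := fun a b =>
    Continuous.intervalIntegrable (by fun_prop) a b
  have h2 : (f s - f 1) ^ 2 ≤ (-Real.log s) * ∫ x in s..1, x * deriv f x ^ 2 := by
    rw [← neg_sq, neg_sub, ← intervalIntegral.integral_deriv_eq_sub' f rfl
      (fun x _ => hf.differentiable (by norm_num) x) hc.continuousOn]
    have e : -Real.log s = ∫ x in s..1, x⁻¹ := by
      rw [integral_inv_of_pos h0 one_pos]; simp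
    rw [e, intervalIntegral.integral_of_le h1, intervalIntegral.integral_of_le h1,
      intervalIntegral.integral_of_le h1]
    have hpos : ∀ᵐ x ∂(volume.restrict (Set.Ioc s 1)), 0 < x := by
      filter_upwards [ae_restrict_mem measurableSet_Ioc] with x hx using h0.trans hx.1
    apply sq_integral_le_mul_integral
    · rw [← IntegrableOn, ← intervalIntegrable_iff_integrableOn_Ioc_of_le h1]
      refine intervalIntegral.intervalIntegrable_inv (fun x hx => ?_) continuousOn_id
      rw [Set.uIcc_of_le h1] at hx
      exact (h0.trans_le hx.1).ne'
    · rw [← IntegrableOn, ← intervalIntegrable_iff_integrableOn_Ioc_of_le h1]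
      exact hd _ _
    · exact hc.integrableOn_Ioc
    · filter_upwards [hpos] with x hx using by positivity
    · filter_upwards [hpos] with x hx using by positivity
    · filter_upwards [hpos] with x hx
      rw [← mul_assoc, inv_mul_cancel₀ hx.ne', one_mul]
  refine h2.trans (mul_le_mul_of_nonneg_left ?_ ?_)
  · refine intervalIntegral.integral_mono_interval h0.le h1 le_rfl ?_ (hd _ _)
    filter_upwards [ae_restrict_mem measurableSet_Ioc] with x hx
    exact mul_nonneg hx.1.le (sq_nonneg _)
  · exact neg_nonneg.2 (Real.log_nonpos h0.le h1)

theorem integral_mul_neg_log : ∫ s in (0 : ℝ)..1, s * (-Real.log s) = 1 / 4 := by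
  have hcont : Continuous fun s : ℝ => s * Real.log s := Real.continuous_mul_log
  have hneg : Continuous fun s : ℝ => s * (-Real.log s) := by
    simp only [mul_neg]; exact hcont.neg
  have h := intervalIntegral.integral_eq_sub_of_hasDerivAt_of_le (a := (0 : ℝ)) (b := 1)
    (f := fun s => s ^ 2 / 4 - s * (s * Real.log s) / 2) (f' := fun s => s * (-Real.log s))
    zero_le_one (by fun_prop)
    (fun x hx => by
      have h1 := ((hasDerivAt_id x).mul (Real.hasDerivAt_mul_log hx.1.ne')).div_const 2
      convert! ((hasDerivAt_pow 2 x).div_const 4).sub h1 using 1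
      simp; ring)
    (hneg.intervalIntegrable _ _)
  rw [h]; simp

/-- Weighted Friedrichs inequality on the unit interval. -/
theorem integral_mul_sq_sub_one_le {f : ℝ → ℝ} (hf : ContDiff ℝ 1 f) :
    ∫ s in (0 : ℝ)..1, s * (f s - f 1) ^ 2 ≤ 1 / 4 * ∫ x in (0 : ℝ)..1, x * deriv f x ^ 2 := by
  have hf0 := hf.continuous
  have hcont : Continuous fun s : ℝ => s * Real.log s := Real.continuous_mul_log
  rw [← integral_mul_neg_log, ← intervalIntegral.integral_mul_const]
  apply intervalIntegral.integral_mono_on zero_le_one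
  · exact Continuous.intervalIntegrable (by fun_prop) _ _
  · refine Continuous.intervalIntegrable (Continuous.mul ?_ continuous_const) _ _
    simp only [mul_neg]; exact hcont.neg
  · intro s hs
    rcases hs.1.eq_or_lt with h | h
    · simp [← h]
    · rw [mul_assoc]
      exact mul_le_mul_of_nonneg_left (sq_sub_one_le_neg_log_mul hf h hs.2) hs.1

theorem integral_mul_eq_sub {f : ℝ → ℝ} (hf : ContDiff ℝ 1 f) :
    ∫ s in (0 : ℝ)..1, s * (f s - f 1) = - (1 / 2) * ∫ s in (0 : ℝ)..1, s ^ 2 * deriv f s := by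
  have hc : Continuous (deriv f) := hf.continuous_deriv le_rfl
  have hf0 := hf.continuous
  have h := intervalIntegral.integral_eq_sub_of_hasDerivAt (a := (0 : ℝ)) (b := 1)
    (f := fun s => s ^ 2 / 2 * (f s - f 1))
    (f' := fun s => s * (f s - f 1) + 1 / 2 * (s ^ 2 * deriv f s))
    (fun x _ => by
      convert! ((hasDerivAt_pow 2 x).div_const 2).mul
        ((hf.hasDerivAt_deriv x).sub_const (f 1)) using 1
      simp; ring)
    (Continuous.intervalIntegrable (by fun_prop) _ _)
  rw [intervalIntegral.integral_add, intervalIntegral.integral_const_mul] at h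
  · simp at h ⊢; linarith
  all_goals exact Continuous.intervalIntegrable (by fun_prop) _ _

/-! ### Integration over triangles -/

/-- Parametrization of the triangle `conv {V, A, B}` by the unit square, singular at `V`. -/
def duffy (V A B : Plane) (p : ℝ × ℝ) : Plane := V + p.1 • ((A - V) + p.2 • (B - A))

/-- The determinant of the edge vectors `A - V` and `B - A`. -/
def triangleDet (V A B : Plane) : ℝ :=
  (A 0 - V 0) * (B 1 - A 1) - (A 1 - V 1) * (B 0 - A 0)

/-- Lebesgue measure on the unit interval. -/
abbrev unitMeasure : Measure ℝ := volume.restrict (Set.Ioc 0 1)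

theorem continuous_duffy (V A B : Plane) : Continuous (duffy V A B) := by
  unfold duffy; fun_prop

theorem convexHull_eq_image_duffy (V A B : Plane) :
    convexHull ℝ {V, A, B} = duffy V A B '' (Set.Icc 0 1 ×ˢ Set.Icc 0 1) := by
  rw [convexHull_insert (by simp), convexHull_pair, convexJoin_singleton_left]
  ext x
  simp only [Set.mem_iUnion, segment_eq_image', Set.mem_image, Set.mem_prod, Prod.exists, duffy]
  constructor
  · rintro ⟨y, ⟨τ, hτ, rfl⟩, s, hs, rfl⟩
    refine ⟨s, τ, ⟨hs, hτ⟩, ?_⟩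
    congr 2; abel
  · rintro ⟨s, τ, ⟨hs, hτ⟩, rfl⟩
    refine ⟨_, ⟨τ, hτ, rfl⟩, s, hs, ?_⟩
    congr 2; abel

theorem measurePreserving_plane :
    MeasurePreserving (fun p : ℝ × ℝ => (!₂[p.1, p.2] : Plane)) ∧
      MeasurableEmbedding (fun p : ℝ × ℝ => (!₂[p.1, p.2] : Plane)) := by
  have h1 := (volume_preserving_finTwoArrow ℝ).symm
  have h2 := (EuclideanSpace.volume_preserving_symm_measurableEquiv_toLp (Fin 2)).symm
  have h3 := h2.comp h1
  have e : (fun p : ℝ × ℝ => (!₂[p.1, p.2] : Plane)) =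
      (MeasurableEquiv.finTwoArrow.symm.trans
        (MeasurableEquiv.toLp 2 (Fin 2 → ℝ)) : ℝ × ℝ ≃ᵐ Plane) := by
    ext p i; fin_cases i <;> rfl
  rw [e]
  exact ⟨h3, MeasurableEquiv.measurableEmbedding _⟩

/-- `duffy` in coordinates. -/
def duffyCoord (V A B : Plane) (p : ℝ × ℝ) : ℝ × ℝ :=
  (V 0 + p.1 * ((A 0 - V 0) + p.2 * (B 0 - A 0)), V 1 + p.1 * ((A 1 - V 1) + p.2 * (B 1 - A 1)))

theorem duffy_eq_duffyCoord (V A B : Plane) (p : ℝ × ℝ) :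
    duffy V A B p = !₂[(duffyCoord V A B p).1, (duffyCoord V A B p).2] := by
  ext i; fin_cases i <;> simp [duffy, duffyCoord, mul_add]

theorem hasFDerivAt_duffyCoord (V A B : Plane) (p : ℝ × ℝ) :
    ∃ f' : ℝ × ℝ →L[ℝ] ℝ × ℝ, HasFDerivAt (duffyCoord V A B) f' p ∧
      f'.det = p.1 * triangleDet V A B := by
  refine ⟨(Matrix.toLin (.finTwoProd ℝ) (.finTwoProd ℝ)
    !![(A 0 - V 0) + p.2 * (B 0 - A 0), p.1 * (B 0 - A 0);
      (A 1 - V 1) + p.2 * (B 1 - A 1), p.1 * (B 1 - A 1)]).toContinuousLinearMap, ?_, ?_⟩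
  · rw [Matrix.toLin_finTwoProd_toContinuousLinearMap]
    have h : ∀ i, HasFDerivAt (fun p : ℝ × ℝ => V i + p.1 * ((A i - V i) + p.2 * (B i - A i)))
        (((A i - V i) + p.2 * (B i - A i)) • ContinuousLinearMap.fst ℝ ℝ ℝ
          + (p.1 * (B i - A i)) • ContinuousLinearMap.snd ℝ ℝ ℝ) p := by
      intro i
      have h1 := ((hasFDerivAt_snd (𝕜 := ℝ) (p := p)).mul_const (B i - A i)).const_add (A i - V i)
      have h2 := ((hasFDerivAt_fst (𝕜 := ℝ) (p := p)).mul h1).const_add (V i)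
      convert! h2 using 1
      ext <;> simp
    exact (h 0).prodMk (h 1)
  · rw [ContinuousLinearMap.det, LinearMap.coe_toContinuousLinearMap, LinearMap.det_toLin,
      Matrix.det_fin_two_of, triangleDet]
    ring

theorem injOn_duffyCoord {V A B : Plane} (h : triangleDet V A B ≠ 0) :
    Set.InjOn (duffyCoord V A B) (Set.Ioo 0 1 ×ˢ Set.Ioo 0 1) := by
  rintro ⟨s, τ⟩ ⟨⟨hs, -⟩, -⟩ ⟨s', τ'⟩ - he
  simp only [duffyCoord, Prod.mk.injEq] at he hs
  obtain ⟨e0, e1⟩ := he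
  unfold triangleDet at h
  have h1 : (s - s') * ((A 0 - V 0) * (B 1 - A 1) - (A 1 - V 1) * (B 0 - A 0)) = 0 := by
    linear_combination (B 1 - A 1) * e0 - (B 0 - A 0) * e1
  have h2 : (s * τ - s' * τ') * ((A 0 - V 0) * (B 1 - A 1) - (A 1 - V 1) * (B 0 - A 0)) = 0 := by
    linear_combination -(A 1 - V 1) * e0 + (A 0 - V 0) * e1
  have h3 : s = s' := by
    rcases mul_eq_zero.1 h1 with h | h
    · linarith
    · contradiction
  subst h3
  have h4 : s * (τ - τ') = 0 := by
    rcases mul_eq_zero.1 h2 with h | h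
    · linarith
    · contradiction
  have h5 : τ = τ' := by
    rcases mul_eq_zero.1 h4 with h | h
    · exact absurd h hs.ne'
    · linarith
  rw [h5]

/-- Change of variables by `duffy`, whose Jacobian is `p.1 * triangleDet V A B`. Injectivity fails
on the side collapsed to `V`, so the formula is applied on the open square; the boundary has null
image. If the determinant vanishes, the image is null and both sides are zero. -/
theorem setIntegral_triangle (V A B : Plane) (F : Plane → ℝ) :
    ∫ x in convexHull ℝ {V, A, B}, F x
      = |triangleDet V A B| * ∫ p, p.1 * F (duffy V A B p) ∂(unitMeasure.prod unitMeasure) := by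
  obtain ⟨hE, hE'⟩ := measurePreserving_plane
  set E : ℝ × ℝ → Plane := fun p => !₂[p.1, p.2] with hEdef
  have hEinj : Function.Injective E := by
    intro p q h
    have h0 := congrArg (fun x : Plane => x 0) h
    have h1 := congrArg (fun x : Plane => x 1) h
    exact Prod.ext (by simpa [E] using h0) (by simpa [E] using h1)
  have himg : E ⁻¹' (convexHull ℝ {V, A, B})
      = duffyCoord V A B '' (Set.Icc 0 1 ×ˢ Set.Icc 0 1) := by
    have : duffy V A B = E ∘ duffyCoord V A B := funext fun p => duffy_eq_duffyCoord V A B p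
    rw [convexHull_eq_image_duffy, this, Set.image_comp, Set.preimage_image_eq _ hEinj]
  rw [← hE.setIntegral_preimage_emb hE', himg]
  have hdiff : Differentiable ℝ (duffyCoord V A B) := fun p =>
    (hasFDerivAt_duffyCoord V A B p).choose_spec.1.differentiableAt
  have hae : (Set.Icc 0 1 ×ˢ Set.Icc 0 1 : Set (ℝ × ℝ)) =ᵐ[volume]
      (Set.Ioo 0 1 ×ˢ Set.Ioo 0 1 : Set (ℝ × ℝ)) :=
    (Measure.set_prod_ae_eq Ioo_ae_eq_Icc Ioo_ae_eq_Icc).symm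
  have hsub : (Set.Ioo 0 1 ×ˢ Set.Ioo 0 1 : Set (ℝ × ℝ)) ⊆ Set.Icc 0 1 ×ˢ Set.Icc 0 1 :=
    Set.prod_mono Set.Ioo_subset_Icc_self Set.Ioo_subset_Icc_self
  have himgae : duffyCoord V A B '' (Set.Icc 0 1 ×ˢ Set.Icc 0 1) =ᵐ[volume]
      duffyCoord V A B '' (Set.Ioo 0 1 ×ˢ Set.Ioo 0 1) := by
    refine (ae_eq_set.2 ⟨?_, ?_⟩)
    · refine measure_mono_null (t := duffyCoord V A B '' ((Set.Icc 0 1 ×ˢ Set.Icc 0 1) \ (Set.Ioo 0 1 ×ˢ Set.Ioo 0 1))) ?_ ?_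
      · rintro _ ⟨⟨p, hp, rfl⟩, h⟩
        exact ⟨p, ⟨hp, fun h' => h ⟨p, h', rfl⟩⟩, rfl⟩
      exact addHaar_image_eq_zero_of_differentiableOn_of_addHaar_eq_zero _
        hdiff.differentiableOn (ae_eq_set.1 hae).1
    · rw [Set.sdiff_eq_empty.2 (Set.image_mono hsub)]; simp
  rw [setIntegral_congr_set himgae]
  have hmeas : MeasurableSet (Set.Ioo 0 1 ×ˢ Set.Ioo 0 1 : Set (ℝ × ℝ)) :=
    measurableSet_Ioo.prod measurableSet_Ioo
  choose f' hf' hdet using hasFDerivAt_duffyCoord V A B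
  by_cases h : triangleDet V A B = 0
  · rw [h, abs_zero, zero_mul]
    apply setIntegral_measure_zero
    refine addHaar_image_eq_zero_of_det_fderivWithin_eq_zero _ (f' := f')
      (fun p _ => (hf' p).hasFDerivWithinAt) (fun p _ => ?_)
    rw [hdet, h, mul_zero]
  · rw [integral_image_eq_integral_abs_det_fderiv_smul _ hmeas
      (fun p _ => (hf' p).hasFDerivWithinAt) (injOn_duffyCoord h), ← integral_const_mul,
      unitMeasure, Measure.prod_restrict, ← Measure.volume_eq_prod]
    have hae' : (Set.Ioc 0 1 ×ˢ Set.Ioc 0 1 : Set (ℝ × ℝ)) =ᵐ[volume]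
        (Set.Ioo 0 1 ×ˢ Set.Ioo 0 1 : Set (ℝ × ℝ)) :=
      Measure.set_prod_ae_eq Ioo_ae_eq_Ioc.symm Ioo_ae_eq_Ioc.symm
    rw [setIntegral_congr_set hae']
    refine setIntegral_congr_fun hmeas fun p hp => ?_
    simp only [hdet, smul_eq_mul, abs_mul, abs_of_pos hp.1.1, duffy_eq_duffyCoord, E]
    ring

theorem Continuous.integrable_unitMeasure {f : ℝ → ℝ} (hf : Continuous f) :
    Integrable f unitMeasure :=
  hf.integrableOn_Ioc

theorem Continuous.integrable_unitMeasure_prod {f : ℝ × ℝ → ℝ} (hf : Continuous f) :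
    Integrable f (unitMeasure.prod unitMeasure) := by
  rw [unitMeasure, Measure.prod_restrict, ← Measure.volume_eq_prod]
  exact (hf.continuousOn.integrableOn_compact (isCompact_Icc.prod isCompact_Icc)).mono_set
    (Set.prod_mono Set.Ioc_subset_Icc_self Set.Ioc_subset_Icc_self)

theorem integral_unitMeasure (f : ℝ → ℝ) : ∫ x, f x ∂unitMeasure = ∫ x in (0 : ℝ)..1, f x :=
  (intervalIntegral.integral_of_le zero_le_one).symm

theorem integral_unitMeasure_prod {f : ℝ × ℝ → ℝ} (hf : Continuous f) :
    ∫ p, f p ∂(unitMeasure.prod unitMeasure) = ∫ s in (0 : ℝ)..1, ∫ τ in (0 : ℝ)..1, f (s, τ) := by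
  rw [integral_prod _ hf.integrable_unitMeasure_prod]
  simp_rw [integral_unitMeasure]

theorem integral_unitMeasure_prod_symm {f : ℝ × ℝ → ℝ} (hf : Continuous f) :
    ∫ p, f p ∂(unitMeasure.prod unitMeasure) = ∫ τ in (0 : ℝ)..1, ∫ s in (0 : ℝ)..1, f (s, τ) := by
  rw [integral_prod_symm _ hf.integrable_unitMeasure_prod]
  simp_rw [integral_unitMeasure]

theorem measureReal_triangle (V A B : Plane) :
    volume.real (convexHull ℝ {V, A, B}) = |triangleDet V A B| / 2 := by
  have h := setIntegral_triangle V A B fun _ => 1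
  rw [integral_unitMeasure_prod (by fun_prop)] at h
  simp at h
  rw [h]; ring

/-! ### Trace and Poincaré inequalities on a triangle -/

/-- Mean value over a segment. -/
def segMean (φ : Plane → ℝ) (A B : Plane) : ℝ := ∫ t in (0 : ℝ)..1, φ (AffineMap.lineMap A B t)

theorem segMean_comm (φ : Plane → ℝ) (A B : Plane) : segMean φ A B = segMean φ B A := by
  unfold segMean
  have h := intervalIntegral.integral_comp_sub_left (a := 0) (b := 1)
    (fun t => φ (AffineMap.lineMap A B t)) 1
  simp only [sub_self, sub_zero] at h
  rw [← h]
  simp_rw [AffineMap.lineMap_apply_one_sub]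

theorem duffy_one_left (V A B : Plane) (τ : ℝ) : duffy V A B (1, τ) = AffineMap.lineMap A B τ := by
  simp only [duffy, AffineMap.lineMap_apply, vsub_eq_sub, vadd_eq_add, one_smul]; abel

theorem duffy_zero_right (V A B : Plane) (s : ℝ) : duffy V A B (s, 0) = AffineMap.lineMap V A s := by
  simp only [duffy, AffineMap.lineMap_apply, vsub_eq_sub, vadd_eq_add, zero_smul, add_zero]; abel

theorem duffy_one_right (V A B : Plane) (s : ℝ) : duffy V A B (s, 1) = AffineMap.lineMap V B s := by
  simp only [duffy, AffineMap.lineMap_apply, vsub_eq_sub, vadd_eq_add, one_smul,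
    add_comm (s • _) V]
  congr 2; abel

theorem contDiff_duffy (V A B : Plane) : ContDiff ℝ 1 (duffy V A B) := by
  unfold duffy; fun_prop

theorem deriv_comp_duffy_left {φ : Plane → ℝ} (hφ : ContDiff ℝ 1 φ) (V A B : Plane) (s τ : ℝ) :
    deriv (fun s => φ (duffy V A B (s, τ))) s
      = fderiv ℝ φ (duffy V A B (s, τ)) ((A - V) + τ • (B - A)) := by
  have h1 : HasDerivAt (fun s => duffy V A B (s, τ)) ((A - V) + τ • (B - A)) s := by
    simpa [duffy] using
      ((hasDerivAt_id s).smul_const ((A - V) + τ • (B - A))).const_add V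
  exact ((hφ.differentiable (by norm_num) _).hasFDerivAt.comp_hasDerivAt s h1).deriv

theorem deriv_comp_duffy_right {φ : Plane → ℝ} (hφ : ContDiff ℝ 1 φ) (V A B : Plane) (s τ : ℝ) :
    deriv (fun τ => φ (duffy V A B (s, τ))) τ
      = fderiv ℝ φ (duffy V A B (s, τ)) (s • (B - A)) := by
  have h1 : HasDerivAt (fun τ => duffy V A B (s, τ)) (s • (B - A)) τ := by
    simpa [duffy] using
      (((((hasDerivAt_id τ).smul_const (B - A)).const_add (A - V)).const_smul s).const_add V)
  exact ((hφ.differentiable (by norm_num) _).hasFDerivAt.comp_hasDerivAt τ h1).deriv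

theorem fderiv_apply_sq_le (φ : Plane → ℝ) (x v : Plane) {h : ℝ} (hv : ‖v‖ ≤ h) :
    (fderiv ℝ φ x v) ^ 2 ≤ h ^ 2 * ‖fderiv ℝ φ x‖ ^ 2 := by
  rw [← mul_pow, ← sq_abs, ← Real.norm_eq_abs]
  refine pow_le_pow_left₀ (norm_nonneg _) ?_ 2
  rw [mul_comm]
  exact (ContinuousLinearMap.le_opNorm _ _).trans
    (mul_le_mul_of_nonneg_left hv (norm_nonneg _))

theorem norm_sub_add_smul_le {V A B : Plane} {h τ : ℝ} (hA : dist A V ≤ h) (hB : dist B V ≤ h)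
    (h0 : 0 ≤ τ) (h1 : τ ≤ 1) : ‖(A - V) + τ • (B - A)‖ ≤ h := by
  have e : (A - V) + τ • (B - A) = (1 - τ) • (A - V) + τ • (B - V) := by module
  rw [dist_eq_norm] at hA hB
  rw [e]
  refine (norm_add_le _ _).trans ?_
  rw [norm_smul, norm_smul, Real.norm_of_nonneg h0, Real.norm_of_nonneg (by linarith)]
  nlinarith

theorem continuous_normSq_fderiv {φ : Plane → ℝ} (hφ : ContDiff ℝ 1 φ) :
    Continuous fun x => ‖fderiv ℝ φ x‖ ^ 2 :=
  ((hφ.continuous_fderiv (by norm_num)).norm.pow 2)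

theorem sq_integral_le_integral_sq {f : ℝ → ℝ} (hf : Continuous f) :
    (∫ x in (0 : ℝ)..1, f x) ^ 2 ≤ ∫ x in (0 : ℝ)..1, f x ^ 2 := by
  have h := sq_integral_le_mul_integral (μ := unitMeasure) (u := fun _ => (1 : ℝ))
    (integrable_const _) (hf.pow 2).integrable_unitMeasure hf.integrable_unitMeasure
    (by simp) (ae_of_all _ fun x => sq_nonneg _) (by simp)
  simpa [integral_unitMeasure] using h

/-- The constant is `1/4 + 1/8`. On each line `p.1 = s` parallel to `AB`, the deviation from `b`
splits into the deviation from the line's own mean, bounded by the Poincaré inequality (`1/8`), and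
the difference between that mean and `b`. By Jensen the latter is bounded by the radial differences
`φ(s, τ) - φ(1, τ)`, to which the weighted Friedrichs inequality applies (`1/4`). -/
theorem duffy_friedrichs {φ : Plane → ℝ} (hφ : ContDiff ℝ 1 φ) {V A B : Plane} {h : ℝ}
    (hA : dist A V ≤ h) (hB : dist B V ≤ h) (hAB : dist A B ≤ h) :
    ∫ p, p.1 * (φ (duffy V A B p) - segMean φ A B) ^ 2 ∂(unitMeasure.prod unitMeasure)
      ≤ 3 / 8 * h ^ 2 *
        ∫ p, p.1 * ‖fderiv ℝ φ (duffy V A B p)‖ ^ 2 ∂(unitMeasure.prod unitMeasure) := by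
  have hd := contDiff_duffy V A B
  have hdc := continuous_duffy V A B
  have hφc := hφ.continuous
  have hN := continuous_normSq_fderiv hφ
  have hNd : Continuous fun p : ℝ × ℝ => p.1 * ‖fderiv ℝ φ (duffy V A B p)‖ ^ 2 :=
    continuous_fst.mul (hN.comp hdc)
  set b := segMean φ A B with hb
  have hb' : b = ∫ τ in (0 : ℝ)..1, φ (duffy V A B (1, τ)) := by
    simp_rw [hb, segMean, duffy_one_left]
  have hvert : ∫ τ in (0 : ℝ)..1, ∫ s in (0 : ℝ)..1,
        s * (φ (duffy V A B (s, τ)) - φ (duffy V A B (1, τ))) ^ 2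
      ≤ ∫ τ in (0 : ℝ)..1, ∫ s in (0 : ℝ)..1,
        1 / 4 * h ^ 2 * (s * ‖fderiv ℝ φ (duffy V A B (s, τ))‖ ^ 2) := by
    apply intervalIntegral.integral_mono_on zero_le_one
    · exact (intervalIntegral.continuous_parametric_intervalIntegral_of_continuous'
        (by fun_prop) _ _).intervalIntegrable _ _
    · refine (intervalIntegral.continuous_parametric_intervalIntegral_of_continuous'
        ?_ _ _).intervalIntegrable _ _
      exact continuous_const.mul (hNd.comp continuous_swap)
    · intro τ hτ
      have hf : ContDiff ℝ 1 fun s => φ (duffy V A B (s, τ)) := hφ.comp (hd.comp (by fun_prop))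
      refine (integral_mul_sq_sub_one_le hf).trans ?_
      rw [← intervalIntegral.integral_const_mul]
      have hfd : Continuous (deriv fun s => φ (duffy V A B (s, τ))) := hf.continuous_deriv le_rfl
      apply intervalIntegral.integral_mono_on zero_le_one
      · exact Continuous.intervalIntegrable (by fun_prop) _ _
      · refine Continuous.intervalIntegrable ?_ _ _
        exact continuous_const.mul (hNd.comp (by fun_prop : Continuous fun s : ℝ => (s, τ)))
      · intro s hs
        rw [deriv_comp_duffy_left hφ]
        have := fderiv_apply_sq_le φ (duffy V A B (s, τ)) _
          (norm_sub_add_smul_le hA hB hτ.1 hτ.2)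
        nlinarith [mul_le_mul_of_nonneg_left this hs.1]
  have hrow : ∀ s ∈ Set.Icc (0 : ℝ) 1, ∫ τ in (0 : ℝ)..1, s * (φ (duffy V A B (s, τ)) - b) ^ 2
      ≤ ∫ τ in (0 : ℝ)..1, (1 / 8 * h ^ 2 * (s * ‖fderiv ℝ φ (duffy V A B (s, τ))‖ ^ 2)
        + s * (φ (duffy V A B (s, τ)) - φ (duffy V A B (1, τ))) ^ 2) := by
    intro s hs
    have hf : ContDiff ℝ 1 fun τ => φ (duffy V A B (s, τ)) := hφ.comp (hd.comp (by fun_prop))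
    have hfc := hf.continuous
    have hfd : Continuous (deriv fun τ => φ (duffy V A B (s, τ))) := hf.continuous_deriv le_rfl
    have hNs : Continuous fun τ => ‖fderiv ℝ φ (duffy V A B (s, τ))‖ ^ 2 :=
      hN.comp (hdc.comp (by fun_prop))
    rw [intervalIntegral.integral_const_mul, integral_sub_const_sq hfc,
      intervalIntegral.integral_add, intervalIntegral.integral_const_mul,
      intervalIntegral.integral_const_mul, intervalIntegral.integral_const_mul]
    rotate_left
    · exact (continuous_const.mul (continuous_const.mul hNs)).intervalIntegrable _ _
    · exact Continuous.intervalIntegrable (by fun_prop) _ _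
    have h1 := integral_sq_sub_mean_le hf
    have h2 : ∫ τ in (0 : ℝ)..1, deriv (fun τ => φ (duffy V A B (s, τ))) τ ^ 2
        ≤ ∫ τ in (0 : ℝ)..1, h ^ 2 * ‖fderiv ℝ φ (duffy V A B (s, τ))‖ ^ 2 := by
      apply intervalIntegral.integral_mono_on zero_le_one
      · exact Continuous.intervalIntegrable (by fun_prop) _ _
      · exact (continuous_const.mul hNs).intervalIntegrable _ _
      · intro τ hτ
        rw [deriv_comp_duffy_right hφ]
        refine fderiv_apply_sq_le φ _ _ ?_
        rw [norm_smul, Real.norm_of_nonneg hs.1, ← dist_eq_norm, dist_comm]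
        nlinarith [hs.1, hs.2, dist_nonneg (x := A) (y := B)]
    rw [intervalIntegral.integral_const_mul] at h2
    have h3 : ((∫ τ in (0 : ℝ)..1, φ (duffy V A B (s, τ))) - b) ^ 2
        ≤ ∫ τ in (0 : ℝ)..1, (φ (duffy V A B (s, τ)) - φ (duffy V A B (1, τ))) ^ 2 := by
      rw [hb', ← intervalIntegral.integral_sub]
      · exact sq_integral_le_integral_sq (by fun_prop)
      all_goals exact Continuous.intervalIntegrable (by fun_prop) _ _
    nlinarith [mul_le_mul_of_nonneg_left (h1.trans (mul_le_mul_of_nonneg_left h2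
      (by norm_num : (0:ℝ) ≤ 1 / 8))) hs.1, mul_le_mul_of_nonneg_left h3 hs.1]
  have hc1 : Continuous fun p : ℝ × ℝ => p.1 * (φ (duffy V A B p) - b) ^ 2 := by fun_prop
  have hc2 : Continuous fun p : ℝ × ℝ =>
      p.1 * (φ (duffy V A B p) - φ (duffy V A B (1, p.2))) ^ 2 := by fun_prop
  have hc3 : Continuous fun p : ℝ × ℝ =>
      1 / 8 * h ^ 2 * (p.1 * ‖fderiv ℝ φ (duffy V A B p)‖ ^ 2) := continuous_const.mul hNd
  have hc4 : Continuous fun p : ℝ × ℝ =>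
      1 / 4 * h ^ 2 * (p.1 * ‖fderiv ℝ φ (duffy V A B p)‖ ^ 2) := continuous_const.mul hNd
  have hc5 : Continuous fun p : ℝ × ℝ =>
      1 / 8 * h ^ 2 * (p.1 * ‖fderiv ℝ φ (duffy V A B p)‖ ^ 2)
        + p.1 * (φ (duffy V A B p) - φ (duffy V A B (1, p.2))) ^ 2 := hc3.add hc2
  calc ∫ p, p.1 * (φ (duffy V A B p) - b) ^ 2 ∂(unitMeasure.prod unitMeasure)
      ≤ ∫ p, (1 / 8 * h ^ 2 * (p.1 * ‖fderiv ℝ φ (duffy V A B p)‖ ^ 2)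
        + p.1 * (φ (duffy V A B p) - φ (duffy V A B (1, p.2))) ^ 2)
          ∂(unitMeasure.prod unitMeasure) := by
        rw [integral_unitMeasure_prod hc1, integral_unitMeasure_prod hc5]
        refine intervalIntegral.integral_mono_on zero_le_one ?_ ?_ hrow
        · exact (intervalIntegral.continuous_parametric_intervalIntegral_of_continuous'
            hc1 _ _).intervalIntegrable _ _
        · exact (intervalIntegral.continuous_parametric_intervalIntegral_of_continuous'
            hc5 _ _).intervalIntegrable _ _
    _ ≤ (∫ p, 1 / 8 * h ^ 2 * (p.1 * ‖fderiv ℝ φ (duffy V A B p)‖ ^ 2)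
          ∂(unitMeasure.prod unitMeasure)) +
        ∫ p, 1 / 4 * h ^ 2 * (p.1 * ‖fderiv ℝ φ (duffy V A B p)‖ ^ 2)
          ∂(unitMeasure.prod unitMeasure) := by
        rw [integral_add hc3.integrable_unitMeasure_prod hc2.integrable_unitMeasure_prod,
          integral_unitMeasure_prod_symm hc2, integral_unitMeasure_prod_symm hc4]
        exact add_le_add_right hvert _
    _ = _ := by
        rw [integral_const_mul, integral_const_mul]; ring

/-- Integration by parts along each ray from `V` turns the left integral into `-1/2 ∫ s² D`, with
`D` the radial derivative. Cauchy–Schwarz with `s⁴ D² = s³ · s D²` and `∫ s³ = 1/4` gives `1/16`. -/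
theorem duffy_integral_sub_sq_le {φ : Plane → ℝ} (hφ : ContDiff ℝ 1 φ) {V A B : Plane} {h : ℝ}
    (hA : dist A V ≤ h) (hB : dist B V ≤ h) :
    (∫ p, p.1 * (φ (duffy V A B p) - segMean φ A B) ∂(unitMeasure.prod unitMeasure)) ^ 2
      ≤ 1 / 16 * h ^ 2 *
        ∫ p, p.1 * ‖fderiv ℝ φ (duffy V A B p)‖ ^ 2 ∂(unitMeasure.prod unitMeasure) := by
  have hd := contDiff_duffy V A B
  have hdc := continuous_duffy V A B
  have hφc := hφ.continuous
  have hN := continuous_normSq_fderiv hφ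
  have hNd : Continuous fun p : ℝ × ℝ => p.1 * ‖fderiv ℝ φ (duffy V A B p)‖ ^ 2 :=
    continuous_fst.mul (hN.comp hdc)
  set D : ℝ × ℝ → ℝ := fun p => fderiv ℝ φ (duffy V A B p) ((A - V) + p.2 • (B - A)) with hD
  have hDc : Continuous D :=
    ((hφ.continuous_fderiv (by norm_num)).comp hdc).clm_apply (by fun_prop)
  have hb' : segMean φ A B = ∫ τ in (0 : ℝ)..1, φ (duffy V A B (1, τ)) := by
    simp_rw [segMean, duffy_one_left]
  have e : ∫ p, p.1 * (φ (duffy V A B p) - segMean φ A B) ∂(unitMeasure.prod unitMeasure)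
      = - (1 / 2) * ∫ p, p.1 ^ 2 * D p ∂(unitMeasure.prod unitMeasure) := by
    have e1 : ∫ p, p.1 * (φ (duffy V A B p) - segMean φ A B) ∂(unitMeasure.prod unitMeasure)
        = ∫ p, p.1 * (φ (duffy V A B p) - φ (duffy V A B (1, p.2)))
          ∂(unitMeasure.prod unitMeasure) := by
      rw [integral_unitMeasure_prod (by fun_prop), integral_unitMeasure_prod (by fun_prop)]
      refine intervalIntegral.integral_congr fun s _ => ?_
      simp only
      rw [intervalIntegral.integral_const_mul, intervalIntegral.integral_const_mul,
        intervalIntegral.integral_sub, intervalIntegral.integral_sub, hb']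
      · simp
      all_goals exact Continuous.intervalIntegrable (by fun_prop) _ _
    rw [e1, integral_unitMeasure_prod_symm (by fun_prop),
      integral_unitMeasure_prod_symm (by fun_prop), ← intervalIntegral.integral_const_mul]
    refine intervalIntegral.integral_congr fun τ _ => ?_
    have hf : ContDiff ℝ 1 fun s => φ (duffy V A B (s, τ)) := hφ.comp (hd.comp (by fun_prop))
    simp only
    rw [integral_mul_eq_sub hf]
    simp_rw [deriv_comp_duffy_left hφ]
    rfl
  have hcs : (∫ p, p.1 ^ 2 * D p ∂(unitMeasure.prod unitMeasure)) ^ 2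
      ≤ (∫ p, p.1 ^ 3 ∂(unitMeasure.prod unitMeasure)) *
        ∫ p, h ^ 2 * (p.1 * ‖fderiv ℝ φ (duffy V A B p)‖ ^ 2)
          ∂(unitMeasure.prod unitMeasure) := by
    have hmem : ∀ᵐ p ∂(unitMeasure.prod unitMeasure),
        p ∈ (Set.Ioc 0 1 ×ˢ Set.Ioc 0 1 : Set (ℝ × ℝ)) := by
      rw [unitMeasure, Measure.prod_restrict]
      exact ae_restrict_mem (measurableSet_Ioc.prod measurableSet_Ioc)
    apply sq_integral_le_mul_integral
    · exact Continuous.integrable_unitMeasure_prod (by fun_prop)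
    · exact (continuous_const.mul hNd).integrable_unitMeasure_prod
    · exact Continuous.integrable_unitMeasure_prod (by fun_prop)
    · filter_upwards [hmem] with p hp using pow_nonneg hp.1.1.le 3
    · filter_upwards [hmem] with p hp
      have := hp.1.1.le
      positivity
    · filter_upwards [hmem] with p hp
      have h1 := fderiv_apply_sq_le φ (duffy V A B p) _
          (norm_sub_add_smul_le hA hB hp.2.1.le hp.2.2)
      have h2 : 0 ≤ p.1 ^ 4 := by positivity
      calc (p.1 ^ 2 * D p) ^ 2 = p.1 ^ 4 * D p ^ 2 := by ring
        _ ≤ p.1 ^ 4 * (h ^ 2 * ‖fderiv ℝ φ (duffy V A B p)‖ ^ 2) :=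
          mul_le_mul_of_nonneg_left h1 h2
        _ = _ := by ring
  have e3 : ∫ p : ℝ × ℝ, p.1 ^ 3 ∂(unitMeasure.prod unitMeasure) = 1 / 4 := by
    rw [integral_unitMeasure_prod (by fun_prop)]
    simp; norm_num
  rw [e3, integral_const_mul] at hcs
  rw [e]
  nlinarith

/-- The sides `VA` and `VB` are the lines `τ = 0` and `τ = 1`, so the difference of means is the
integral of the `τ`-derivative `s D`, with `D` the derivative along `B - A`. Cauchy–Schwarz uses `∫
s = 1/2`. -/
theorem duffy_segMean_sub_sq_le {φ : Plane → ℝ} (hφ : ContDiff ℝ 1 φ) {V A B : Plane} {h : ℝ}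
    (hAB : dist A B ≤ h) :
    (segMean φ V B - segMean φ V A) ^ 2
      ≤ 1 / 2 * h ^ 2 *
        ∫ p, p.1 * ‖fderiv ℝ φ (duffy V A B p)‖ ^ 2 ∂(unitMeasure.prod unitMeasure) := by
  have hd := contDiff_duffy V A B
  have hdc := continuous_duffy V A B
  have hφc := hφ.continuous
  have hN := continuous_normSq_fderiv hφ
  have hNd : Continuous fun p : ℝ × ℝ => p.1 * ‖fderiv ℝ φ (duffy V A B p)‖ ^ 2 :=
    continuous_fst.mul (hN.comp hdc)
  set D : ℝ × ℝ → ℝ := fun p => fderiv ℝ φ (duffy V A B p) (B - A) with hD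
  have hDc : Continuous D :=
    ((hφ.continuous_fderiv (by norm_num)).comp hdc).clm_apply continuous_const
  have e : segMean φ V B - segMean φ V A = ∫ p, p.1 * D p ∂(unitMeasure.prod unitMeasure) := by
    rw [integral_unitMeasure_prod (by fun_prop), segMean, segMean, ← intervalIntegral.integral_sub]
    rotate_left
    · exact Continuous.intervalIntegrable (hφc.comp (AffineMap.lineMap_continuous)) _ _
    · exact Continuous.intervalIntegrable (hφc.comp (AffineMap.lineMap_continuous)) _ _
    refine intervalIntegral.integral_congr fun s _ => ?_
    have hf : ContDiff ℝ 1 fun τ => φ (duffy V A B (s, τ)) := hφ.comp (hd.comp (by fun_prop))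
    have := intervalIntegral.integral_deriv_eq_sub' (a := 0) (b := 1)
      (fun τ => φ (duffy V A B (s, τ))) rfl (fun x _ => hf.differentiable (by norm_num) x)
      (hf.continuous_deriv le_rfl).continuousOn
    simp only [duffy_one_right, duffy_zero_right] at this
    simp only
    rw [← this]
    simp_rw [deriv_comp_duffy_right hφ, map_smul, smul_eq_mul, hD]
  have hcs : (∫ p, p.1 * D p ∂(unitMeasure.prod unitMeasure)) ^ 2
      ≤ (∫ p, p.1 ∂(unitMeasure.prod unitMeasure)) *
        ∫ p, h ^ 2 * (p.1 * ‖fderiv ℝ φ (duffy V A B p)‖ ^ 2)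
          ∂(unitMeasure.prod unitMeasure) := by
    have hmem : ∀ᵐ p ∂(unitMeasure.prod unitMeasure),
        p ∈ (Set.Ioc 0 1 ×ˢ Set.Ioc 0 1 : Set (ℝ × ℝ)) := by
      rw [unitMeasure, Measure.prod_restrict]
      exact ae_restrict_mem (measurableSet_Ioc.prod measurableSet_Ioc)
    apply sq_integral_le_mul_integral
    · exact Continuous.integrable_unitMeasure_prod (by fun_prop)
    · exact (continuous_const.mul hNd).integrable_unitMeasure_prod
    · exact Continuous.integrable_unitMeasure_prod (by fun_prop)
    · filter_upwards [hmem] with p hp using hp.1.1.le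
    · filter_upwards [hmem] with p hp
      have := hp.1.1.le
      positivity
    · filter_upwards [hmem] with p hp
      rw [dist_comm, dist_eq_norm] at hAB
      have h1 := fderiv_apply_sq_le φ (duffy V A B p) _ hAB
      calc (p.1 * D p) ^ 2 = p.1 ^ 2 * D p ^ 2 := by ring
        _ ≤ p.1 ^ 2 * (h ^ 2 * ‖fderiv ℝ φ (duffy V A B p)‖ ^ 2) :=
          mul_le_mul_of_nonneg_left h1 (by positivity)
        _ = _ := by ring
  have e3 : ∫ p : ℝ × ℝ, p.1 ∂(unitMeasure.prod unitMeasure) = 1 / 2 := by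
    rw [integral_unitMeasure_prod (by fun_prop)]
    simp
  rw [e3, integral_const_mul] at hcs
  rw [e]
  linarith

theorem isCompact_triangle (V A B : Plane) : IsCompact (convexHull ℝ {V, A, B}) :=
  (Set.toFinite _).isCompact_convexHull ℝ

theorem Continuous.integrableOn_triangle {F : Plane → ℝ} (hF : Continuous F) (V A B : Plane) :
    IntegrableOn F (convexHull ℝ {V, A, B}) :=
  hF.continuousOn.integrableOn_compact (isCompact_triangle V A B)

theorem triangle_friedrichs {φ : Plane → ℝ} (hφ : ContDiff ℝ 1 φ) {V A B : Plane} {h : ℝ}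
    (hA : dist A V ≤ h) (hB : dist B V ≤ h) (hAB : dist A B ≤ h) :
    ∫ x in convexHull ℝ {V, A, B}, (φ x - segMean φ A B) ^ 2
      ≤ 3 / 8 * h ^ 2 * ∫ x in convexHull ℝ {V, A, B}, ‖fderiv ℝ φ x‖ ^ 2 := by
  rw [setIntegral_triangle, setIntegral_triangle]
  have := mul_le_mul_of_nonneg_left (duffy_friedrichs hφ hA hB hAB) (abs_nonneg (triangleDet V A B))
  linarith

theorem triangle_integral_sub_sq_le {φ : Plane → ℝ} (hφ : ContDiff ℝ 1 φ) {V A B : Plane} {h : ℝ}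
    (hA : dist A V ≤ h) (hB : dist B V ≤ h) :
    (∫ x in convexHull ℝ {V, A, B}, (φ x - segMean φ A B)) ^ 2
      ≤ volume.real (convexHull ℝ {V, A, B}) *
        (h ^ 2 / 8 * ∫ x in convexHull ℝ {V, A, B}, ‖fderiv ℝ φ x‖ ^ 2) := by
  rw [setIntegral_triangle, setIntegral_triangle, measureReal_triangle]
  have := mul_le_mul_of_nonneg_left (duffy_integral_sub_sq_le hφ hA hB)
    (sq_nonneg |triangleDet V A B|)
  linarith

theorem triangle_segMean_sub_sq_le {φ : Plane → ℝ} (hφ : ContDiff ℝ 1 φ) {V A B : Plane} {h : ℝ}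
    (hAB : dist A B ≤ h) :
    volume.real (convexHull ℝ {V, A, B}) * (segMean φ V B - segMean φ V A) ^ 2
      ≤ h ^ 2 * (∫ x in convexHull ℝ {V, A, B}, ‖fderiv ℝ φ x‖ ^ 2) / 4 := by
  rw [setIntegral_triangle, measureReal_triangle]
  have := mul_le_mul_of_nonneg_left (duffy_segMean_sub_sq_le hφ (V := V) hAB)
    (abs_nonneg (triangleDet V A B))
  linarith

/-- Expand the square around the mean `b` over `AB`. Young's inequality shares the cross term
between the two summands: `11/16 = 3/8 + 5/16` and `7/5 = 1 + 2/5`. -/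
theorem triangle_integral_sub_const_sq_le {φ : Plane → ℝ} (hφ : ContDiff ℝ 1 φ) {V A B : Plane}
    {h : ℝ} (hA : dist A V ≤ h) (hB : dist B V ≤ h) (hAB : dist A B ≤ h) (a : ℝ) :
    ∫ x in convexHull ℝ {V, A, B}, (φ x - a) ^ 2
      ≤ 11 / 16 * (h ^ 2 * ∫ x in convexHull ℝ {V, A, B}, ‖fderiv ℝ φ x‖ ^ 2)
        + 7 / 5 * (volume.real (convexHull ℝ {V, A, B}) * (segMean φ A B - a) ^ 2) := by
  have hφc := hφ.continuous
  have h1 := triangle_friedrichs hφ hA hB hAB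
  have h2 := triangle_integral_sub_sq_le hφ hA hB
  set b := segMean φ A B
  set T := convexHull ℝ {V, A, B} with hT
  have e : ∫ x in T, (φ x - a) ^ 2 = (∫ x in T, (φ x - b) ^ 2)
      + 2 * (b - a) * (∫ x in T, (φ x - b)) + volume.real T * (b - a) ^ 2 := by
    have e1 : ∀ x, (φ x - a) ^ 2 = (φ x - b) ^ 2 + (2 * (b - a) * (φ x - b) + (b - a) ^ 2) :=
      fun x => by ring
    have hi : ∀ F : Plane → ℝ, Continuous F → IntegrableOn F T := fun F hF =>
      hF.integrableOn_triangle V A B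
    simp_rw [e1]
    rw [integral_add (hi _ (by fun_prop)) (hi _ (by fun_prop)),
      integral_add (hi _ (by fun_prop)) (hi _ (by fun_prop)), integral_const_mul]
    simp only [integral_const, measureReal_restrict_apply_univ, smul_eq_mul]
    ring
  rw [e]
  set I := ∫ x in T, (φ x - b)
  set g := ∫ x in T, ‖fderiv ℝ φ x‖ ^ 2
  have hg : 0 ≤ h ^ 2 * g :=
    mul_nonneg (sq_nonneg _) (integral_nonneg fun x => sq_nonneg _)
  have ht : 0 ≤ volume.real T := measureReal_nonneg
  set t := volume.real T
  -- Young with parameter `2/5`, where `h2` bounds `I²` by `t h² g / 8`. The choice keeps the final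
  -- factor below `M + 1/4` for every `m ≥ 3`.
  have h3 : 2 * (b - a) * I ≤ 2 / 5 * (t * (b - a) ^ 2) + 5 / 16 * (h ^ 2 * g) := by
    rcases ht.eq_or_lt with h0 | h0
    · rw [← h0, zero_mul] at h2
      have : I = 0 := pow_eq_zero_iff two_ne_zero |>.1 (le_antisymm h2 (sq_nonneg _))
      rw [this, ← h0]; linarith
    · refine le_of_mul_le_mul_left ?_ h0
      nlinarith [sq_nonneg (2 * (t * (b - a)) - 5 * I)]
  linarith

/-! ### A discrete Friedrichs inequality on a cycle -/

/-- The summand is the number of triangles crossed on the shorter way from triangle `0` to triangle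
`n`. Passing from `m` to `m + 2` adds one term at each end and raises the others by one. -/
theorem sum_range_min_sub (m : ℕ) : ∑ n ∈ Finset.range m, min n (m - n) = m ^ 2 / 4 := by
  induction m using Nat.twoStepInduction with
  | zero => simp
  | one => simp
  | more m ih _ =>
    rw [Finset.sum_range_succ', Finset.sum_range_succ]
    have e : ∀ n ∈ Finset.range m, min (n + 1) (m + 2 - (n + 1)) = min n (m - n) + 1 := by
      intro n hn
      have := Finset.mem_range.1 hn
      omega
    rw [Finset.sum_congr rfl e, Finset.sum_add_distrib, ih]
    have : (m + 2) ^ 2 = m ^ 2 + 4 * (m + 1) := by ring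
    rw [this]
    simp
    omega

/-- Cauchy–Schwarz along a path `s` of triangles. Since the path avoids the target `n`, the energy
`g n` can be subtracted on the right; `cycle_sum_le` depends on this gain. -/
theorem mul_sq_sum_le_of_path {g d : ℕ → ℝ} {tmin tmax t : ℝ} (hmin : 0 < tmin) (h0 : 0 ≤ t)
    (ht : t ≤ tmax) (hg : ∀ n, 0 ≤ g n) {m n : ℕ} (hn : n < m) {s : Finset ℕ}
    (hs : s ⊆ (Finset.range m).erase n) (hd : ∀ l ∈ s, tmin * d l ^ 2 ≤ g l / 4) :
    t * (∑ l ∈ s, d l) ^ 2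
      ≤ tmax / tmin * (s.card / 4 * ((∑ l ∈ Finset.range m, g l) - g n)) := by
  have h1 : (∑ l ∈ s, d l) ^ 2 ≤ s.card * ∑ l ∈ s, d l ^ 2 := sq_sum_le_card_mul_sum_sq
  have h2 : tmin * ∑ l ∈ s, d l ^ 2 ≤ (∑ l ∈ s, g l) / 4 := by
    rw [Finset.mul_sum, Finset.sum_div]
    exact Finset.sum_le_sum hd
  have h3 : ∑ l ∈ s, g l ≤ (∑ l ∈ Finset.range m, g l) - g n := by
    rw [← Finset.sum_erase_eq_sub (Finset.mem_range.2 hn)]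
    exact Finset.sum_le_sum_of_subset_of_nonneg hs fun i _ _ => hg i
  have h4 : tmin * (∑ l ∈ s, d l) ^ 2
      ≤ s.card / 4 * ((∑ l ∈ Finset.range m, g l) - g n) := by
    calc tmin * (∑ l ∈ s, d l) ^ 2 ≤ tmin * (s.card * ∑ l ∈ s, d l ^ 2) :=
          mul_le_mul_of_nonneg_left h1 hmin.le
      _ = s.card * (tmin * ∑ l ∈ s, d l ^ 2) := by ring
      _ ≤ s.card * ((∑ l ∈ s, g l) / 4) := mul_le_mul_of_nonneg_left h2 (Nat.cast_nonneg _)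
      _ ≤ s.card * (((∑ l ∈ Finset.range m, g l) - g n) / 4) := by gcongr
      _ = _ := by ring
  calc t * (∑ l ∈ s, d l) ^ 2 ≤ tmax * (∑ l ∈ s, d l) ^ 2 :=
        mul_le_mul_of_nonneg_right ht (sq_nonneg _)
    _ = tmax / tmin * (tmin * (∑ l ∈ s, d l) ^ 2) := by field_simp
    _ ≤ _ := mul_le_mul_of_nonneg_left h4 (div_nonneg (h0.trans ht) hmin.le)

/-- Here `g` is `h²` times the energy of a triangle, `t` its area, `b` a spoke mean and `a` the mean
over the outer edge of triangle `0`. Each `b n` is reached from `a` by a chain of increments, each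
of them paid for by the triangle it crosses. -/
theorem cycle_sum_le {m : ℕ} {I g t b : ℕ → ℝ} {a tmin tmax : ℝ} (hmin : 0 < tmin)
    (ht : ∀ n, tmin ≤ t n) (ht' : ∀ n, t n ≤ tmax) (hg : ∀ n, 0 ≤ g n) (hb : b m = b 0)
    (H0 : I 0 ≤ 3 / 8 * g 0)
    (H1 : ∀ n, I n ≤ 11 / 16 * g n + 7 / 5 * (t n * (b n - a) ^ 2))
    (H2 : ∀ n, I n ≤ 11 / 16 * g n + 7 / 5 * (t n * (b (n + 1) - a) ^ 2))
    (S : ∀ n, t n * (b (n + 1) - b n) ^ 2 ≤ g n / 4)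
    (S0 : t 0 * (b 0 - a) ^ 2 ≤ g 0 / 4) (S1 : t 0 * (b 1 - a) ^ 2 ≤ g 0 / 4) :
    ∑ n ∈ Finset.range m, I n
      ≤ (3 / 8 + 7 / 20 * ((m ^ 2 / 4 : ℕ) : ℝ)) * (tmax / tmin) * ∑ n ∈ Finset.range m, g n := by
  have scale : ∀ n (x y : ℝ), t n * x ^ 2 ≤ y → tmin * x ^ 2 ≤ y := fun n x y h =>
    (mul_le_mul_of_nonneg_right (ht n) (sq_nonneg x)).trans h
  have ht0 : ∀ n, 0 ≤ t n := fun n => hmin.le.trans (ht n)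
  have hq : 1 ≤ tmax / tmin := (one_le_div hmin).2 ((ht 0).trans (ht' 0))
  set q := tmax / tmin with hqdef
  set G := ∑ n ∈ Finset.range m, g n with hG
  -- The path crosses triangles `0, …, n - 1`: from `a` to `b 1` inside triangle `0`, then from
  -- spoke to spoke.
  have forward : ∀ n, 1 ≤ n → n < m → t n * (b n - a) ^ 2 ≤ q * (n / 4 * (G - g n)) := by
    intro n h1 hn
    have hsum : ∀ k, b (k + 1) - a
        = ∑ l ∈ Finset.range (k + 1), (if l = 0 then b 1 - a else b (l + 1) - b l) := by
      intro k
      induction k with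
      | zero => simp
      | succ k ih => rw [Finset.sum_range_succ, ← ih]; simp
    obtain ⟨k, rfl⟩ : ∃ k, n = k + 1 := ⟨n - 1, by omega⟩
    rw [hsum k]
    have := mul_sq_sum_le_of_path (tmax := tmax) hmin (ht0 (k + 1)) (ht' (k + 1)) hg hn
      (s := Finset.range (k + 1))
      (d := fun l => if l = 0 then b 1 - a else b (l + 1) - b l)
      (fun l hl => by
        rw [Finset.mem_range] at hl
        rw [Finset.mem_erase, Finset.mem_range]; omega)
      (fun l _ => by
        by_cases h : l = 0
        · subst h; simpa using scale 0 _ _ S1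
        · simpa [h] using scale l _ _ (S l))
    simpa using this
  have backward : ∀ n, 1 ≤ n → n < m →
      t n * (b (n + 1) - a) ^ 2 ≤ q * (((m - n : ℕ) : ℝ) / 4 * (G - g n)) := by
    intro n h1 hn
    -- The path goes the other way: from `a` to `b 0 = b m` inside triangle `0`, then down through
    -- triangles `m - 1, …, n + 1`, which makes `m - n` steps.
    set d : ℕ → ℝ := fun l => if l = 0 then b 0 - a else -(b (l + 1) - b l) with hd
    have hsum : b (n + 1) - a = ∑ l ∈ insert 0 (Finset.Ico (n + 1) m), d l := by
      rw [Finset.sum_insert (by simp)]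
      have e : ∑ l ∈ Finset.Ico (n + 1) m, d l
          = ∑ l ∈ Finset.Ico (n + 1) m, -(b (l + 1) - b l) := by
        refine Finset.sum_congr rfl fun l hl => ?_
        have : l ≠ 0 := by rw [Finset.mem_Ico] at hl; omega
        simp [hd, this]
      rw [e, Finset.sum_neg_distrib, Finset.sum_Ico_sub b (by omega), hb]
      simp [hd]
    rw [hsum]
    have hc : (insert 0 (Finset.Ico (n + 1) m)).card = m - n := by
      rw [Finset.card_insert_of_notMem (by simp), Nat.card_Ico]; omega
    have := mul_sq_sum_le_of_path (tmax := tmax) hmin (ht0 n) (ht' n) hg hn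
      (s := insert 0 (Finset.Ico (n + 1) m)) (d := d)
      (fun l hl => by
        rw [Finset.mem_insert, Finset.mem_Ico] at hl
        rw [Finset.mem_erase, Finset.mem_range]; omega)
      (fun l _ => by
        by_cases h : l = 0
        · subst h; simpa [hd] using scale 0 _ _ S0
        · simp only [hd, if_neg h, neg_sq]
          exact scale l _ _ (S l))
    rwa [hc] at this
  have gG : ∀ n, n < m → g n ≤ G := fun n hn =>
    Finset.single_le_sum (f := g) (fun i _ => hg i) (Finset.mem_range.2 hn)
  have hG0 : 0 ≤ G := Finset.sum_nonneg fun i _ => hg i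
  have each : ∀ n ∈ Finset.range m,
      I n ≤ 3 / 8 * g n + 7 / 20 * q * ((min n (m - n) : ℕ) : ℝ) * G := by
    intro n hn
    rw [Finset.mem_range] at hn
    rcases Nat.eq_zero_or_pos n with rfl | h1
    · simpa using H0
    · have hmin' : I n ≤ 11 / 16 * g n
          + 7 / 5 * (q * (((min n (m - n) : ℕ) : ℝ) / 4 * (G - g n))) := by
        rcases le_total n (m - n) with h | h
        · rw [min_eq_left h]
          linarith [H1 n, forward n h1 hn]
        · rw [min_eq_right h]
          linarith [H2 n, backward n h1 hn]
      have hk : (1 : ℝ) ≤ ((min n (m - n) : ℕ) : ℝ) := by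
        exact_mod_cast (by omega : 1 ≤ min n (m - n))
      -- The omitted energy absorbs part of the local term: `11/16 - 7/20 ≤ 3/8`.
      have : 1 * g n ≤ q * ((min n (m - n) : ℕ) : ℝ) * g n :=
        mul_le_mul_of_nonneg_right (one_le_mul_of_one_le_of_one_le hq hk) (hg n)
      linarith [hg n]
  refine (Finset.sum_le_sum each).trans ?_
  rw [Finset.sum_add_distrib, ← Finset.mul_sum, ← Finset.sum_mul, ← Finset.mul_sum,
    ← Nat.cast_sum, sum_range_min_sub]
  have := mul_le_mul_of_nonneg_right hq hG0
  linarith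

theorem sum_fin_eq_sum_range_add {m : ℕ} [NeZero m] (i : Fin m) (F : Fin m → ℝ) :
    ∑ j, F j = ∑ n ∈ Finset.range m, F (i + Fin.ofNat m n) := by
  rw [← Equiv.sum_comp (Equiv.addLeft i), Finset.sum_range]
  simp

/-- From `1 - cos x ≤ x²/2` one gets `M ≥ m²/π² ≥ m²/9.9`, while the left side grows at most like
`(7/80) m²`. -/
theorem constant_le_cos {m : ℕ} (hm : 3 ≤ m) :
    3 / 8 + 7 / 20 * ((m ^ 2 / 4 : ℕ) : ℝ) ≤ 1 / (2 * (1 - Real.cos (Real.pi / m))) + 1 / 4 := by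
  have hm0 : (0 : ℝ) < m := by positivity
  have hm3 : (3 : ℝ) ≤ m := by exact_mod_cast hm
  have hpi := Real.pi_pos
  have hpi3 := Real.pi_lt_d4
  have hx : 0 < Real.pi / m := by positivity
  have hc : 1 - (Real.pi / m) ^ 2 / 2 < Real.cos (Real.pi / m) :=
    Real.one_sub_sq_div_two_lt_cos hx.ne'
  have hc1 : Real.cos (Real.pi / m) < 1 := by
    rw [← Real.cos_zero]
    refine Real.cos_lt_cos_of_nonneg_of_le_pi le_rfl (div_le_self hpi.le (by linarith)) hx
  have h1 : (m : ℝ) ^ 2 / Real.pi ^ 2 ≤ 1 / (2 * (1 - Real.cos (Real.pi / m))) := by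
    have : (m : ℝ) ^ 2 / Real.pi ^ 2 = 1 / (Real.pi / m) ^ 2 := by field_simp
    rw [this]
    exact one_div_le_one_div_of_le (by linarith) (by linarith)
  have h2 : (m : ℝ) ^ 2 * (1 / 9.9) ≤ (m : ℝ) ^ 2 / Real.pi ^ 2 := by
    rw [div_eq_mul_one_div ((m : ℝ) ^ 2) (Real.pi ^ 2)]
    have hpp : Real.pi ^ 2 ≤ 9.9 := by nlinarith
    exact mul_le_mul_of_nonneg_left (one_div_le_one_div_of_le (by positivity) hpp) (by positivity)
  have h3 : ((m ^ 2 / 4 : ℕ) : ℝ) ≤ (m : ℝ) ^ 2 / 4 := by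
    have := Nat.cast_div_le (α := ℝ) (m := m ^ 2) (n := 4)
    push_cast at this
    exact this
  -- For `m = 3` the bound `⌊m²/4⌋ ≤ m²/4` is too lossy; the exact value `2` is needed.
  rcases hm.eq_or_lt with rfl | h4
  · norm_num at h1 h2 ⊢
  · have h4' : (4 : ℝ) ≤ m := by exact_mod_cast h4
    nlinarith

/-! ### The triangulation of a polygonal domain -/

theorem volume_segment (A B : Plane) : volume (segment ℝ A B) = 0 := by
  have h := measureReal_triangle A A B
  have e : ({A, A, B} : Set Plane) = {A, B} := by simp
  rw [e, convexHull_pair, triangleDet] at h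
  simp only [sub_self, zero_mul, abs_zero, zero_div] at h
  rw [measureReal_def, ENNReal.toReal_eq_zero_iff] at h
  refine h.resolve_right (ne_of_lt ?_)
  rw [← convexHull_pair]
  exact ((Set.toFinite _).isCompact_convexHull ℝ).measure_lt_top

theorem IsPolygonalDomain.ae_eq_interior {m : ℕ} [NeZero m] {P : Set Plane} {z : Fin m → Plane}
    (hP : IsPolygonalDomain P z) : interior P =ᵐ[volume] P := by
  refine ae_eq_set.2 ⟨by simp [Set.sdiff_eq_empty.2 interior_subset], ?_⟩
  have : P \ interior P = frontier P := by
    rw [frontier, hP.isCompact.isClosed.closure_eq]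
  rw [this, hP.frontier_eq]
  exact measure_iUnion_null fun j => volume_segment _ _

theorem IsPolygonalDomain.edge_subset {m : ℕ} [NeZero m] {P : Set Plane} {z : Fin m → Plane}
    (hP : IsPolygonalDomain P z) (j : Fin m) : segment ℝ (z j) (z (j + 1)) ⊆ frontier P := by
  rw [hP.frontier_eq]
  exact Set.subset_iUnion (fun j => polyEdge z j) j

theorem IsPolygonalDomain.mem {m : ℕ} [NeZero m] {P : Set Plane} {z : Fin m → Plane}
    (hP : IsPolygonalDomain P z) (j : Fin m) : z j ∈ P :=
  hP.isCompact.isClosed.frontier_subset (hP.edge_subset j (left_mem_segment _ _ _))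

theorem fin_add_one_ne {m : ℕ} [NeZero m] (hm : 3 ≤ m) (j : Fin m) :
    j + 1 ≠ j ∧ j + 1 + 1 ≠ j := by
  obtain ⟨n, rfl⟩ : ∃ n, m = n + 3 := ⟨m - 3, by omega⟩
  have h1 : (1 : Fin (n + 3)) ≠ 0 := by simp
  have h2 : (1 + 1 : Fin (n + 3)) ≠ 0 := by
    intro h
    have := congrArg Fin.val h
    simp [Fin.val_add] at this
    rw [Nat.mod_eq_of_lt (by omega)] at this
    omega
  refine ⟨fun h => h1 (by simp at h), fun h => h2 ?_⟩
  rw [add_assoc] at h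
  simpa using h

theorem IsPolygonalDomain.node_ne {m : ℕ} [NeZero m] {P : Set Plane} {z : Fin m → Plane}
    (hP : IsPolygonalDomain P z) (j : Fin m) : z j ≠ z (j + 1) := fun h =>
  (fin_add_one_ne hP.three_le j).1 (hP.injective h).symm

section Fan

variable {m : ℕ} [NeZero m] {P : Set Plane} {z : Fin m → Plane} {c : Plane}

/-- As `m ≥ 3`, two different triangles share at most `c` and one further node, so they meet inside
a segment. -/
theorem IsSubtriangulation.aedisjoint (hP : IsPolygonalDomain P z) (hT : IsSubtriangulation P z c) :
    Pairwise (Function.onFun (AEDisjoint volume) fun j => subTriangle z c j) := by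
  intro j k hjk
  have hz : ∀ i, z i ≠ c := by
    intro i h
    have h1 := hP.edge_subset i (left_mem_segment _ _ _)
    rw [h] at h1
    exact h1.2 hT.interior_node
  change volume (subTriangle z c j ∩ subTriangle z c k) = 0
  rw [hT.inter j k hjk]
  have key : subVertices z c j ∩ subVertices z c k ⊆ {c, z j} ∨
      subVertices z c j ∩ subVertices z c k ⊆ {c, z (j + 1)} := by
    by_cases h : z (j + 1) ∈ subVertices z c k
    · right
      rintro x ⟨hx, hxk⟩
      rcases hx with rfl | rfl | rfl
      · simp
      · exfalso
        simp only [subVertices, Set.mem_insert_iff, Set.mem_singleton_iff, hz, false_or,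
          hP.injective.eq_iff] at h hxk
        have h1 : j + 1 = k := by
          rcases h with h | h
          · exact h
          · exact absurd (add_right_cancel h) hjk
        have h2 : j = k + 1 := hxk.resolve_left hjk
        rw [← h1] at h2
        exact (fin_add_one_ne hP.three_le j).2 h2.symm
      · simp
    · left
      rintro x ⟨hx, hxk⟩
      rcases hx with rfl | rfl | rfl
      · simp
      · simp
      · exact absurd hxk h
  rcases key with h | h
  · refine measure_mono_null (convexHull_mono h) ?_
    rw [convexHull_pair]; exact volume_segment _ _
  · refine measure_mono_null (convexHull_mono h) ?_
    rw [convexHull_pair]; exact volume_segment _ _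

theorem IsSubtriangulation.setIntegral_eq_sum (hP : IsPolygonalDomain P z)
    (hT : IsSubtriangulation P z c) {F : Plane → ℝ} (hF : Continuous F) :
    ∫ x in interior P, F x = ∑ j, ∫ x in subTriangle z c j, F x := by
  rw [setIntegral_congr_set hP.ae_eq_interior]
  conv_lhs => rw [hT.cover]
  rw [integral_iUnion_ae _ (hT.aedisjoint hP), tsum_fintype]
  · rw [← hT.cover]
    exact hF.continuousOn.integrableOn_compact hP.isCompact
  · exact fun j => (isCompact_triangle _ _ _).measurableSet.nullMeasurableSet

theorem IsSubtriangulation.area_pos (hT : IsSubtriangulation P z c) (j : Fin m) :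
    0 < volume.real (subTriangle z c j) := by
  have h1 : (interior (subTriangle z c j)).Nonempty := by
    rw [subTriangle, interior_convexHull_nonempty_iff_affineSpan_eq_top]
    have h2 := (hT.nondegenerate j).affineSpan_eq_top_iff_card_eq_finrank_add_one.2 (by simp)
    have h3 : Set.range ![c, z j, z (j + 1)] = subVertices z c j := by
      rw [Matrix.range_cons, Matrix.range_cons_cons_empty]; rfl
    rwa [h3] at h2
  have h4 : volume (subTriangle z c j) < ⊤ := (isCompact_triangle _ _ _).measure_lt_top
  exact ENNReal.toReal_pos (Measure.measure_pos_of_nonempty_interior _ h1).ne' h4.ne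

theorem IsSubtriangulation.integral_sub_segMean_sq_le (hP : IsPolygonalDomain P z)
    (hT : IsSubtriangulation P z c) {φ : Plane → ℝ} (hφ : ContDiff ℝ 1 φ) (i : Fin m) :
    ∫ x in interior P, (φ x - segMean φ (z i) (z (i + 1))) ^ 2
      ≤ (1 / (2 * (1 - Real.cos (Real.pi / m))) + 1 / 4) * (maxArea z c / minArea z c) *
        (Metric.diam P ^ 2 * ∫ x in interior P, ‖fderiv ℝ φ x‖ ^ 2) := by
  have hφc := hφ.continuous
  have hN := continuous_normSq_fderiv hφ
  set h := Metric.diam P with hh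
  set a := segMean φ (z i) (z (i + 1)) with ha
  have hcP : c ∈ P := interior_subset hT.interior_node
  have hd : ∀ x ∈ P, ∀ y ∈ P, dist x y ≤ h := fun x hx y hy =>
    Metric.dist_le_diam_of_mem hP.isCompact.isBounded hx hy
  have hz := hP.mem
  -- The triangle lemmas single out one vertex. The permutations rename it so that the sides whose
  -- means are compared are spokes or the outer edge.
  have perm1 : ∀ j, ({z (j + 1), c, z j} : Set Plane) = subVertices z c j := fun j => by
    ext x; simp only [subVertices, Set.mem_insert_iff, Set.mem_singleton_iff]; tauto
  have perm2 : ∀ j, ({z j, c, z (j + 1)} : Set Plane) = subVertices z c j := fun j => by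
    ext x; simp only [subVertices, Set.mem_insert_iff, Set.mem_singleton_iff]; tauto
  have perm3 : ∀ j, ({z j, z (j + 1), c} : Set Plane) = subVertices z c j := fun j => by
    ext x; simp only [subVertices, Set.mem_insert_iff, Set.mem_singleton_iff]; tauto
  have perm4 : ∀ j, ({z (j + 1), z j, c} : Set Plane) = subVertices z c j := fun j => by
    ext x; simp only [subVertices, Set.mem_insert_iff, Set.mem_singleton_iff]; tauto
  set g : Fin m → ℝ := fun j => h ^ 2 * ∫ x in subTriangle z c j, ‖fderiv ℝ φ x‖ ^ 2 with hg
  set I : Fin m → ℝ := fun j => ∫ x in subTriangle z c j, (φ x - a) ^ 2 with hI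
  set t : Fin m → ℝ := fun j => volume.real (subTriangle z c j) with ht
  set b : Fin m → ℝ := fun j => segMean φ c (z j) with hb
  have H0 : I i ≤ 3 / 8 * g i := by
    have := triangle_friedrichs hφ (hd _ (hz i) _ hcP) (hd _ (hz (i + 1)) _ hcP)
      (hd _ (hz i) _ (hz (i + 1)))
    rw [mul_assoc] at this
    exact this
  have H1 : ∀ j, I j ≤ 11 / 16 * g j + 7 / 5 * (t j * (b j - a) ^ 2) := fun j => by
    have := triangle_integral_sub_const_sq_le hφ (hd _ hcP _ (hz (j + 1)))
      (hd _ (hz j) _ (hz (j + 1))) (hd _ hcP _ (hz j)) a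
    rw [perm1] at this
    exact this
  have H2 : ∀ j, I j ≤ 11 / 16 * g j + 7 / 5 * (t j * (b (j + 1) - a) ^ 2) := fun j => by
    have := triangle_integral_sub_const_sq_le hφ (hd _ hcP _ (hz j))
      (hd _ (hz (j + 1)) _ (hz j)) (hd _ hcP _ (hz (j + 1))) a
    rw [perm2] at this
    exact this
  have S : ∀ j, t j * (b (j + 1) - b j) ^ 2 ≤ g j / 4 := fun j =>
    triangle_segMean_sub_sq_le hφ (V := c) (hd _ (hz j) _ (hz (j + 1)))
  have S0 : t i * (b i - a) ^ 2 ≤ g i / 4 := by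
    have := triangle_segMean_sub_sq_le hφ (V := z i) (hd _ (hz (i + 1)) _ hcP)
    rw [perm3, segMean_comm φ (z i) c] at this
    exact this
  have S1 : t i * (b (i + 1) - a) ^ 2 ≤ g i / 4 := by
    have := triangle_segMean_sub_sq_le hφ (V := z (i + 1)) (hd _ (hz i) _ hcP)
    rw [perm4, segMean_comm φ (z (i + 1)) c, segMean_comm φ (z (i + 1)) (z i)] at this
    exact this
  have hmin : 0 < minArea z c := (Finset.lt_inf'_iff _).2 fun j _ => hT.area_pos j
  have ht1 : ∀ j, minArea z c ≤ t j := fun j => Finset.inf'_le _ (Finset.mem_univ j)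
  have ht2 : ∀ j, t j ≤ maxArea z c := fun j =>
    Finset.le_sup' (fun j => volume.real (subTriangle z c j)) (Finset.mem_univ j)
  have hg0 : ∀ j, 0 ≤ g j := fun j =>
    mul_nonneg (sq_nonneg _) (integral_nonneg fun x => sq_nonneg _)
  have e0 : Fin.ofNat m 0 = 0 := rfl
  have em : Fin.ofNat m m = 0 := by ext; simp [Fin.ofNat]
  have es : ∀ n, i + Fin.ofNat m (n + 1) = i + Fin.ofNat m n + 1 := by
    intro n
    rw [add_assoc]
    congr 1
    ext
    simp [Fin.ofNat, Fin.val_add]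
  -- The cycle is rotated so that triangle `i` gets the number `0`; the indices wrap around, whence
  -- `b m = b 0`.
  have key := cycle_sum_le (m := m) (I := fun n => I (i + Fin.ofNat m n))
    (g := fun n => g (i + Fin.ofNat m n)) (t := fun n => t (i + Fin.ofNat m n))
    (b := fun n => b (i + Fin.ofNat m n)) (a := a) hmin (fun n => ht1 _) (fun n => ht2 _)
    (fun n => hg0 _) (by rw [em, e0]) (by simpa [e0] using H0) (fun n => H1 _)
    (fun n => by simp only [es]; exact H2 _) (fun n => by simp only [es]; exact S _)
    (by simpa [e0] using S0) (by simp only [es 0, e0, add_zero]; exact S1)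
  rw [← sum_fin_eq_sum_range_add i I, ← sum_fin_eq_sum_range_add i g] at key
  rw [hT.setIntegral_eq_sum hP (by fun_prop), hT.setIntegral_eq_sum hP hN, Finset.mul_sum]
  refine key.trans (mul_le_mul_of_nonneg_right ?_ (Finset.sum_nonneg fun j _ => hg0 j))
  exact mul_le_mul_of_nonneg_right (constant_le_cos hP.three_le)
    (div_nonneg (hmin.le.trans ((ht1 i).trans (ht2 i))) hmin.le)

end Fan

/-! ### Passage from smooth functions to Sobolev functions -/

theorem eLpNorm_two_eq_sqrt {E : Type*} [NormedAddCommGroup E] {U : Set Plane}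
    (hU : Bornology.IsBounded U) {F : Plane → E} (hF : Continuous F) :
    eLpNorm F 2 (volume.restrict U) = ENNReal.ofReal √(∫ x in U, ‖F x‖ ^ 2) := by
  have hi : Integrable (fun x => ‖F x‖ ^ 2) (volume.restrict U) := by
    refine IntegrableOn.mono_set ?_ subset_closure
    exact (hF.norm.pow 2).continuousOn.integrableOn_compact hU.isCompact_closure
  have hm : MemLp F 2 (volume.restrict U) :=
    (memLp_two_iff_integrable_sq_norm hF.aestronglyMeasurable).2 hi
  rw [hm.eLpNorm_eq_integral_rpow_norm two_ne_zero ENNReal.ofNat_ne_top, Real.sqrt_eq_rpow]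
  simp

theorem enorm_integral_sub_le {u v : ℝ → ℝ} (hu : Continuous u)
    (hv : MemLp v 2 (volume.restrict (Set.Icc 0 1))) :
    ‖(∫ t in (0 : ℝ)..1, u t) - ∫ t in (0 : ℝ)..1, v t‖ₑ
      ≤ eLpNorm (fun t => u t - v t) 2 (volume.restrict (Set.Icc 0 1)) := by
  have : IsProbabilityMeasure (volume.restrict (Set.Icc (0 : ℝ) 1)) := ⟨by simp⟩
  have hvi : IntegrableOn v (Set.Icc 0 1) := hv.integrable (by norm_num)
  rw [← intervalIntegral.integral_sub (hu.intervalIntegrable _ _)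
    ((intervalIntegrable_iff_integrableOn_Icc_of_le zero_le_one).2 hvi),
    intervalIntegral.integral_of_le zero_le_one, ← integral_Icc_eq_integral_Ioc]
  refine (enorm_integral_le_lintegral_enorm _).trans ?_
  rw [← eLpNorm_one_eq_lintegral_enorm]
  exact eLpNorm_le_eLpNorm_of_exponent_le (by norm_num)
    (hu.aestronglyMeasurable.sub hv.aestronglyMeasurable)

theorem norm_gradient_eq (φ : Plane → ℝ) (x : Plane) : ‖gradient φ x‖ = ‖fderiv ℝ φ x‖ := by
  simp [gradient]

theorem continuous_gradient {φ : Plane → ℝ} (hφ : ContDiff ℝ 1 φ) : Continuous (gradient φ) := by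
  unfold gradient
  exact (LinearIsometryEquiv.continuous _).comp (hφ.continuous_fderiv (by norm_num))

section Sobolev

variable {m : ℕ} [NeZero m] {P : Set Plane} {z : Fin m → Plane}

/-- Apply `H` to the approximating functions in the definition of the trace. Their edge means
converge because on the unit interval the `L²` norm dominates the `L¹` norm. -/
theorem eLpNorm_sub_edge_mean_le (hP : IsPolygonalDomain P z) {K : ℝ} (hK : 0 ≤ K) (i : Fin m)
    (H : ∀ φ : Plane → ℝ, ContDiff ℝ 1 φ →
      ∫ x in interior P, (φ x - segMean φ (z i) (z (i + 1))) ^ 2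
        ≤ K ^ 2 * ∫ x in interior P, ‖fderiv ℝ φ x‖ ^ 2)
    {f : Plane → ℝ} {G : Plane → Plane} {g : Plane → ℝ}
    (hf : IsH1WithGradient (interior P) f G) (hg : IsTrace P z f G g) :
    eLpNorm (fun x => f x - ∫ t in (0 : ℝ)..1, g (AffineMap.lineMap (z i) (z (i + 1)) t)) 2
        (volume.restrict (interior P))
      ≤ ENNReal.ofReal K * eLpNorm G 2 (volume.restrict (interior P)) := by
  obtain ⟨hgm, φ, hφ, h1, h2, h3⟩ := hg
  have hφ1 : ∀ n, ContDiff ℝ 1 (φ n) := fun n => (hφ n).of_le (by exact_mod_cast le_top)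
  have hb : Bornology.IsBounded (interior P) := hP.isCompact.isBounded.subset interior_subset
  set μ := volume.restrict (interior P) with hμ
  set a := ∫ t in (0 : ℝ)..1, g (AffineMap.lineMap (z i) (z (i + 1)) t) with ha
  have hμfin : μ Set.univ ≠ ⊤ := by
    rw [hμ, Measure.restrict_apply_univ]; exact hb.measure_lt_top.ne
  set ν := μ Set.univ ^ (1 / (2 : ENNReal).toReal) with hν
  have hνfin : ν ≠ ⊤ := ENNReal.rpow_ne_top_of_nonneg (by simp) hμfin
  have smooth : ∀ n, eLpNorm (fun x => φ n x - segMean (φ n) (z i) (z (i + 1))) 2 μ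
      ≤ ENNReal.ofReal K * eLpNorm (gradient (φ n)) 2 μ := by
    intro n
    have hc := (hφ n).continuous
    rw [hμ, eLpNorm_two_eq_sqrt hb (by fun_prop), eLpNorm_two_eq_sqrt hb
      (continuous_gradient (hφ1 n)), ← ENNReal.ofReal_mul hK]
    refine ENNReal.ofReal_le_ofReal ?_
    simp_rw [norm_gradient_eq, Real.norm_eq_abs, sq_abs]
    refine Real.sqrt_le_iff.2 ⟨by positivity, ?_⟩
    rw [mul_pow, Real.sq_sqrt (integral_nonneg fun x => sq_nonneg _)]
    exact H _ (hφ1 n)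
  have bound : ∀ n, eLpNorm (fun x => f x - a) 2 μ
      ≤ eLpNorm (fun x => φ n x - f x) 2 μ
        + (ENNReal.ofReal K * (eLpNorm (fun x => gradient (φ n) x - G x) 2 μ + eLpNorm G 2 μ)
        + eLpNorm (fun t : ℝ => φ n (AffineMap.lineMap (z i) (z (i + 1)) t)
            - g (AffineMap.lineMap (z i) (z (i + 1)) t)) 2 (volume.restrict (Set.Icc 0 1)) * ν) := by
    intro n
    have hc := (hφ n).continuous
    set an := segMean (φ n) (z i) (z (i + 1)) with han
    have e : (fun x => f x - a) = (fun x => -(φ n x - f x)) + ((fun x => φ n x - an)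
        + fun _ => an - a) := by
      ext x; simp
    have m1 : AEStronglyMeasurable (fun x => -(φ n x - f x)) μ :=
      (hc.aestronglyMeasurable.sub hf.memLp.aestronglyMeasurable).neg
    have m2 : AEStronglyMeasurable (fun x => φ n x - an) μ :=
      (hc.sub continuous_const).aestronglyMeasurable
    rw [e]
    refine (eLpNorm_add_le m1 (m2.add aestronglyMeasurable_const) (by norm_num)).trans ?_
    refine add_le_add (le_of_eq (eLpNorm_neg (fun x => φ n x - f x) _ _)) ?_
    refine (eLpNorm_add_le m2 aestronglyMeasurable_const (by norm_num)).trans ?_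
    refine add_le_add ((smooth n).trans (mul_le_mul_right ?_ _)) ?_
    · have e' : gradient (φ n) = (fun x => gradient (φ n) x - G x) + G := by ext1 x; simp
      conv_lhs => rw [e']
      exact eLpNorm_add_le ((continuous_gradient (hφ1 n)).aestronglyMeasurable.sub
        hf.memLp_grad.aestronglyMeasurable) hf.memLp_grad.aestronglyMeasurable (by norm_num)
    · rw [eLpNorm_const' _ two_ne_zero ENNReal.ofNat_ne_top]
      exact mul_le_mul_left (enorm_integral_sub_le
        (hc.comp AffineMap.lineMap_continuous) (hgm i)) _
  have lim := h1.add ((ENNReal.Tendsto.const_mul (a := ENNReal.ofReal K)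
    (h2.add_const (eLpNorm G 2 μ)) (Or.inr ENNReal.ofReal_ne_top)).add
    (ENNReal.Tendsto.mul_const (b := ν) (h3 i) (Or.inr hνfin)))
  rw [zero_mul, zero_add, zero_add, add_zero] at lim
  exact ge_of_tendsto' lim bound

/-- With `L j` the edge lengths and `a j` the edge means, `∑ L j * a j = 0` gives `(∑ L j) f = ∑ L j
(f - a j)`. Each summand has the same bound, so `J` does not affect the constant. -/
theorem poincareFriedrichs_of_contDiff (hP : IsPolygonalDomain P z) {C : ℝ} (hC : 0 ≤ C)
    (H : ∀ φ : Plane → ℝ, ContDiff ℝ 1 φ → ∀ i,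
      ∫ x in interior P, (φ x - segMean φ (z i) (z (i + 1))) ^ 2
        ≤ (C * Metric.diam P) ^ 2 * ∫ x in interior P, ‖fderiv ℝ φ x‖ ^ 2) :
    PoincareFriedrichs P z C := by
  intro f G g hf hg J hJ hsum
  have hK : 0 ≤ C * Metric.diam P := mul_nonneg hC Metric.diam_nonneg
  have hi := fun i => eLpNorm_sub_edge_mean_le hP hK i (fun φ hφ => H φ hφ i) hf hg
  set μ := volume.restrict (interior P) with hμ
  set a : Fin m → ℝ := fun i => ∫ t in (0 : ℝ)..1, g (AffineMap.lineMap (z i) (z (i + 1)) t)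
  set L : Fin m → ℝ := fun i => dist (z i) (z (i + 1)) with hL
  have hLpos : ∀ i, 0 < L i := fun i => dist_pos.2 (hP.node_ne i)
  have hsum' : ∑ j ∈ J, L j * a j = 0 := hsum
  have hW : 0 < ∑ j ∈ J, L j := Finset.sum_pos (fun j _ => hLpos j) hJ
  have e : (∑ j ∈ J, L j) • f = ∑ j ∈ J, L j • fun x => f x - a j := by
    ext x
    simp only [Pi.smul_apply, smul_eq_mul, Finset.sum_apply, mul_sub, Finset.sum_sub_distrib,
      hsum', Finset.sum_mul, sub_zero]
  have h1 : ENNReal.ofReal (∑ j ∈ J, L j) * eLpNorm f 2 μ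
      ≤ ENNReal.ofReal (∑ j ∈ J, L j) * (ENNReal.ofReal (C * Metric.diam P) * eLpNorm G 2 μ) := by
    rw [← Real.enorm_of_nonneg hW.le, ← eLpNorm_const_smul, e, Real.enorm_of_nonneg hW.le,
      ENNReal.ofReal_sum_of_nonneg fun j _ => (hLpos j).le, Finset.sum_mul]
    refine (eLpNorm_sum_le (fun j _ => ?_) (by norm_num)).trans (Finset.sum_le_sum fun j _ => ?_)
    · exact (hf.memLp.aestronglyMeasurable.sub aestronglyMeasurable_const).const_smul _
    · rw [eLpNorm_const_smul, Real.enorm_of_nonneg (hLpos j).le]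
      exact mul_le_mul_right (hi j) _
  have h2 := (ENNReal.mul_le_mul_iff_right (ENNReal.ofReal_pos.2 hW).ne'
    ENNReal.ofReal_ne_top).1 h1
  have h3 := ENNReal.toReal_mono
    (ENNReal.mul_ne_top ENNReal.ofReal_ne_top hf.memLp_grad.eLpNorm_ne_top) h2
  rwa [ENNReal.toReal_mul, ENNReal.toReal_ofReal hK] at h3

theorem poincareFriedrichs_constPF {c : Plane} (hP : IsPolygonalDomain P z)
    (hT : IsSubtriangulation P z c) :
    PoincareFriedrichs P z (constPF m (maxArea z c / minArea z c)) := by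
  refine poincareFriedrichs_of_contDiff hP (Real.sqrt_nonneg _) fun φ hφ i => ?_
  refine (hT.integral_sub_segMean_sq_le hP hφ i).trans ?_
  have hmin : 0 < minArea z c := (Finset.lt_inf'_iff _).2 fun j _ => hT.area_pos j
  have hmax : 0 ≤ maxArea z c := (hT.area_pos i).le.trans
    (Finset.le_sup' (fun j => volume.real (subTriangle z c j)) (Finset.mem_univ i))
  have hM : 0 ≤ 1 / (2 * (1 - Real.cos (Real.pi / m))) :=
    div_nonneg zero_le_one (mul_nonneg zero_le_two (sub_nonneg.2 (Real.cos_le_one _)))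
  have hq : 0 ≤ maxArea z c / minArea z c := div_nonneg hmax hmin.le
  have h0 : 0 ≤ Metric.diam P ^ 2 * ∫ x in interior P, ‖fderiv ℝ φ x‖ ^ 2 :=
    mul_nonneg (sq_nonneg _) (integral_nonneg fun x => sq_nonneg _)
  rw [constPF, mul_pow, Real.sq_sqrt (by positivity)]
  -- `C_P²` enters only as a nonnegative surplus, so nothing about the Bessel root is required.
  linarith [mul_nonneg (sq_nonneg (1 / besselRoot)) h0]

end Sobolev

/-! ### Domains that are star-shaped with respect to a ball -/

/-- The homothety centred at `y` with ratio `1 - θ` maps a ball around `x` onto a ball around the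
given point, and star-shapedness keeps the image in `P`. -/
theorem mem_interior_of_starConvex_ball {P : Set Plane} {c : Plane} {r : ℝ}
    (hs : ∀ x ∈ Metric.ball c r, StarConvex ℝ x P) {x y : Plane} (hx : x ∈ Metric.ball c r)
    (hy : y ∈ P) {θ : ℝ} (h0 : 0 ≤ θ) (h1 : θ < 1) : (1 - θ) • x + θ • y ∈ interior P := by
  rw [Metric.mem_ball] at hx
  have hθ : 0 < 1 - θ := by linarith
  rw [mem_interior]
  refine ⟨Metric.ball ((1 - θ) • x + θ • y) ((1 - θ) * (r - dist x c)), ?_, Metric.isOpen_ball,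
    Metric.mem_ball_self (mul_pos hθ (by linarith))⟩
  intro w hw
  set v := (1 - θ)⁻¹ • (w - ((1 - θ) • x + θ • y)) with hv
  have hvn : ‖v‖ < r - dist x c := by
    rw [hv, norm_smul, norm_inv, Real.norm_of_nonneg hθ.le, inv_mul_lt_iff₀ hθ, ← dist_eq_norm]
    exact hw
  have hxv : x + v ∈ Metric.ball c r := by
    rw [Metric.mem_ball]
    calc dist (x + v) c ≤ dist (x + v) x + dist x c := dist_triangle _ _ _
      _ = ‖v‖ + dist x c := by rw [dist_eq_norm]; simp
      _ < r := by linarith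
  have := hs _ hxv hy hθ.le h0 (by ring)
  have e : (1 - θ) • (x + v) + θ • y = w := by
    rw [smul_add, hv, smul_inv_smul₀ hθ.ne']; abel
  rwa [e] at this

/-- If the line through the edge met the ball at `x`, some point of the edge would lie strictly
between `x` and an endpoint, hence in the interior of `P`. The point at parameter `3/4` serves when
`κ ≤ 1/2`, the one at `1/4` otherwise. -/
theorem lineMap_notMem_ball_of_starConvex {P : Set Plane} {c : Plane} {r : ℝ}
    (hs : ∀ x ∈ Metric.ball c r, StarConvex ℝ x P) {A B : Plane} (hA : A ∈ P) (hB : B ∈ P)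
    (hAB : segment ℝ A B ⊆ frontier P) (κ : ℝ) : A + κ • (B - A) ∉ Metric.ball c r := by
  intro hx
  have hseg : ∀ τ ∈ Set.Icc (0 : ℝ) 1, A + τ • (B - A) ∉ interior P := fun τ hτ h => by
    have : A + τ • (B - A) ∈ segment ℝ A B := by
      rw [segment_eq_image']; exact ⟨τ, hτ, rfl⟩
    exact (hAB this).2 h
  rcases le_or_gt κ (1 / 2) with hκ | hκ
  · have h1 : 0 < 1 - κ := by linarith
    set θ := (3 / 4 - κ) / (1 - κ) with hθ
    have hθ0 : 0 ≤ θ := div_nonneg (by linarith) h1.le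
    have hθ1 : θ < 1 := (div_lt_one h1).2 (by linarith)
    have e : (1 - θ) • (A + κ • (B - A)) + θ • B = A + (3 / 4 : ℝ) • (B - A) := by
      have h3 : (3 / 4 : ℝ) = κ + θ * (1 - κ) := by rw [hθ]; field_simp; ring
      rw [h3]; module
    have := mem_interior_of_starConvex_ball hs hx hB hθ0 hθ1
    rw [e] at this
    exact hseg _ ⟨by norm_num, by norm_num⟩ this
  · have h1 : 0 < κ := by linarith
    set θ := (κ - 1 / 4) / κ with hθ
    have hθ0 : 0 ≤ θ := div_nonneg (by linarith) h1.le
    have hθ1 : θ < 1 := (div_lt_one h1).2 (by linarith)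
    have e : (1 - θ) • (A + κ • (B - A)) + θ • A = A + (1 / 4 : ℝ) • (B - A) := by
      have h3 : (1 / 4 : ℝ) = κ - θ * κ := by rw [hθ]; field_simp; ring
      rw [h3]; module
    have := mem_interior_of_starConvex_ball hs hx hA hθ0 hθ1
    rw [e] at this
    exact hseg _ ⟨by norm_num, by norm_num⟩ this

theorem plane_dist_sq (x y : Plane) : dist x y ^ 2 = (x 0 - y 0) ^ 2 + (x 1 - y 1) ^ 2 := by
  rw [EuclideanSpace.dist_eq, Real.sq_sqrt (by positivity), Fin.sum_univ_two, Real.dist_eq,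
    Real.dist_eq, sq_abs, sq_abs]

/-- The quotient `|triangleDet c A B| / dist A B` is the distance from `c` to the line `AB`. The
foot of the perpendicular, at parameter `κ`, lies outside the ball. -/
theorem mul_dist_le_abs_triangleDet {P : Set Plane} {c : Plane} {r : ℝ} (hr : 0 < r)
    (hs : ∀ x ∈ Metric.ball c r, StarConvex ℝ x P) {A B : Plane} (hne : A ≠ B) (hA : A ∈ P)
    (hB : B ∈ P) (hAB : segment ℝ A B ⊆ frontier P) :
    r * dist A B ≤ |triangleDet c A B| := by
  by_contra! hlt
  have hL : 0 < dist A B := dist_pos.2 hne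
  have hsq : triangleDet c A B ^ 2 < (r * dist A B) ^ 2 := by
    rw [← sq_abs]; exact pow_lt_pow_left₀ hlt (abs_nonneg _) two_ne_zero
  have hL2 := plane_dist_sq A B
  set κ := ((c 0 - A 0) * (B 0 - A 0) + (c 1 - A 1) * (B 1 - A 1)) / dist A B ^ 2 with hκ
  refine lineMap_notMem_ball_of_starConvex hs hA hB hAB κ ?_
  rw [Metric.mem_ball]
  refine lt_of_pow_lt_pow_left₀ 2 hr.le ?_
  have hLL : 0 < dist A B ^ 2 := by positivity
  refine lt_of_mul_lt_mul_left ?_ hLL.le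
  have hk : κ * dist A B ^ 2 = (c 0 - A 0) * (B 0 - A 0) + (c 1 - A 1) * (B 1 - A 1) := by
    rw [hκ]; field_simp
  have e : dist A B ^ 2 * dist (A + κ • (B - A)) c ^ 2 = triangleDet c A B ^ 2 := by
    rw [plane_dist_sq (A + κ • (B - A)) c]
    simp only [PiLp.add_apply, PiLp.smul_apply, PiLp.sub_apply, smul_eq_mul, triangleDet]
    have h1 : dist A B ^ 2 * ((A 0 + κ * (B 0 - A 0) - c 0) ^ 2
        + (A 1 + κ * (B 1 - A 1) - c 1) ^ 2)
        = dist A B ^ 2 * ((A 0 - c 0) ^ 2 + (A 1 - c 1) ^ 2)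
          - 2 * (κ * dist A B ^ 2) * ((c 0 - A 0) * (B 0 - A 0) + (c 1 - A 1) * (B 1 - A 1))
          + (κ * dist A B ^ 2) * (κ * ((A 0 - B 0) ^ 2 + (A 1 - B 1) ^ 2)) := by ring
    rw [h1, ← hL2, hk, hL2]
    ring
  rw [e]
  linarith [mul_pow r (dist A B) 2]

/-! ### Poincaré inequality with the mean over a subset, by integration along segments -/

theorem lintegral_add_smul_le {k : Plane → ENNReal} (hk : Measurable k) (u : Plane) {t : ℝ}
    (ht : 1 / 2 ≤ t) : ∫⁻ y, k (u + t • y) ≤ 4 * ∫⁻ y, k y := by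
  have ht0 : t ≠ 0 := by linarith
  have h1 : ∫⁻ y, k (u + t • y) = ENNReal.ofReal |(t ^ 2)⁻¹| * ∫⁻ y, k y := by
    have h2 : ∫⁻ y, k (u + t • y) = ∫⁻ w, k (u + w) ∂(Measure.map (t • ·) volume) :=
      (lintegral_map (f := fun w => k (u + w)) (by fun_prop) (by fun_prop)).symm
    rw [h2, Measure.map_addHaar_smul _ ht0, lintegral_smul_measure, smul_eq_mul,
      lintegral_add_left_eq_self]
    simp
  rw [h1]
  refine mul_le_mul_left ?_ _
  rw [show (4 : ENNReal) = ENNReal.ofReal 4 by simp]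
  refine ENNReal.ofReal_le_ofReal ?_
  rw [abs_of_nonneg (by positivity)]
  rw [inv_le_comm₀ (by positivity) (by norm_num)]
  nlinarith

/-- The point `x + t • (y - x)` moves at rate `t` with `y` and `1 - t` with `x`. Substituting in
whichever variable has rate at least `1/2` costs a Jacobian factor of at most `4`, uniformly in `t`.
-/
theorem lintegral_lintegral_segment_le {S B : Set Plane} (hBS : B ⊆ S) {k : Plane → ENNReal}
    (hk : Measurable k) {t : ℝ} :
    ∫⁻ x in S, ∫⁻ y in B, k (x + t • (y - x)) ≤ 4 * volume S * ∫⁻ y, k y := by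
  have hswap : ∫⁻ x in S, ∫⁻ y in B, k (x + t • (y - x))
      = ∫⁻ y in B, ∫⁻ x in S, k (x + t • (y - x)) := by
    refine lintegral_lintegral_swap (Measurable.aemeasurable ?_)
    refine hk.comp (Continuous.measurable ?_)
    fun_prop
  rcases le_total (1 / 2) t with ht | ht
  · calc ∫⁻ x in S, ∫⁻ y in B, k (x + t • (y - x))
        ≤ ∫⁻ x in S, 4 * ∫⁻ y, k y := by
          refine lintegral_mono fun x => (setLIntegral_le_lintegral _ _).trans ?_
          have := lintegral_add_smul_le hk ((1 - t) • x) ht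
          refine le_trans (le_of_eq (lintegral_congr fun y => ?_)) this
          congr 1; module
      _ = 4 * volume S * ∫⁻ y, k y := by
          rw [setLIntegral_const]; ring
  · rw [hswap]
    calc ∫⁻ y in B, ∫⁻ x in S, k (x + t • (y - x))
        ≤ ∫⁻ y in B, 4 * ∫⁻ x, k x := by
          refine lintegral_mono fun y => (setLIntegral_le_lintegral _ _).trans ?_
          have := lintegral_add_smul_le hk (t • y) (t := 1 - t) (by linarith)
          refine le_trans (le_of_eq (lintegral_congr fun x => ?_)) this
          congr 1; module
      _ ≤ 4 * volume S * ∫⁻ y, k y := by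
          rw [setLIntegral_const, mul_right_comm]
          gcongr

theorem sq_sub_le_lintegral_segment {φ : Plane → ℝ} (hφ : ContDiff ℝ 1 φ) {S : Set Plane}
    {x y : Plane} {h : ℝ} (hxy : dist y x ≤ h) (hseg : segment ℝ x y ⊆ S) :
    ENNReal.ofReal ((φ x - φ y) ^ 2) ≤ ENNReal.ofReal (h ^ 2) * ∫⁻ t in Set.Ioc (0 : ℝ) 1,
      S.indicator (fun w => ENNReal.ofReal (‖fderiv ℝ φ w‖ ^ 2)) (x + t • (y - x)) := by
  have hN := continuous_normSq_fderiv hφ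
  have hf : ContDiff ℝ 1 fun t : ℝ => φ (x + t • (y - x)) := hφ.comp (by fun_prop)
  have hNc : Continuous fun t : ℝ => h ^ 2 * ‖fderiv ℝ φ (x + t • (y - x))‖ ^ 2 :=
    continuous_const.mul (hN.comp (by fun_prop : Continuous fun t : ℝ => x + t • (y - x)))
  have h1 := sq_sub_le_sub_mul_integral hf zero_le_one
  simp only [zero_smul, add_zero, one_smul, add_sub_cancel, sub_zero, one_mul] at h1
  have h2 : ∫ t in (0 : ℝ)..1, deriv (fun t : ℝ => φ (x + t • (y - x))) t ^ 2
      ≤ ∫ t in (0 : ℝ)..1, h ^ 2 * ‖fderiv ℝ φ (x + t • (y - x))‖ ^ 2 := by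
    refine intervalIntegral.integral_mono_on zero_le_one
      (((hf.continuous_deriv le_rfl).pow 2).intervalIntegrable _ _)
      (hNc.intervalIntegrable _ _) fun t _ => ?_
    have hd : HasDerivAt (fun t : ℝ => x + t • (y - x)) (y - x) t := by
      simpa using ((hasDerivAt_id t).smul_const (y - x)).const_add x
    have hd' : deriv (fun t : ℝ => φ (x + t • (y - x))) t = fderiv ℝ φ (x + t • (y - x)) (y - x) :=
      ((hφ.differentiable (by norm_num) _).hasFDerivAt.comp_hasDerivAt t hd).deriv
    rw [hd']
    exact fderiv_apply_sq_le φ _ _ (by rwa [← dist_eq_norm])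
  have h3 : (φ x - φ y) ^ 2 ≤ ∫ t in Set.Ioc (0 : ℝ) 1,
      h ^ 2 * ‖fderiv ℝ φ (x + t • (y - x))‖ ^ 2 := by
    rw [← intervalIntegral.integral_of_le zero_le_one, ← neg_sq, neg_sub]
    exact h1.trans h2
  refine (ENNReal.ofReal_le_ofReal h3).trans ?_
  rw [ofReal_integral_eq_lintegral_ofReal hNc.integrableOn_Ioc
    (ae_of_all _ fun t => by positivity), ← lintegral_const_mul' _ _ ENNReal.ofReal_ne_top]
  refine setLIntegral_mono' measurableSet_Ioc fun t ht => ?_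
  rw [ENNReal.ofReal_mul (sq_nonneg _), Set.indicator_of_mem]
  apply hseg
  rw [segment_eq_image']
  exact ⟨t, ⟨ht.1.le, ht.2⟩, rfl⟩

/-- Take `β` to be the mean over `B`. Jensen replaces `φ x - β` by `φ x - φ y`, the fundamental
theorem of calculus along the segment brings in the gradient, and the integration over `t` is moved
outermost so that the uniform bound in `t` applies. -/
theorem exists_integral_sub_sq_le_of_segment_subset {φ : Plane → ℝ} (hφ : ContDiff ℝ 1 φ)
    {S B : Set Plane} (hS : IsCompact S) (hB : MeasurableSet B) (hBS : B ⊆ S)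
    (hB0 : 0 < volume.real B) (hseg : ∀ x ∈ S, ∀ y ∈ B, segment ℝ x y ⊆ S) :
    ∃ β : ℝ, volume.real B * ∫ x in S, (φ x - β) ^ 2
      ≤ Metric.diam S ^ 2 * (4 * volume.real S * ∫ x in S, ‖fderiv ℝ φ x‖ ^ 2) := by
  have hφc := hφ.continuous
  have hN := continuous_normSq_fderiv hφ
  have hSfin : volume S ≠ ⊤ := hS.measure_lt_top.ne
  have hBfin : volume B ≠ ⊤ := ne_top_of_le_ne_top hSfin (measure_mono hBS)
  have hiS : ∀ F : Plane → ℝ, Continuous F → IntegrableOn F S := fun F hF =>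
    hF.continuousOn.integrableOn_compact hS
  have hiB : ∀ F : Plane → ℝ, Continuous F → IntegrableOn F B := fun F hF => (hiS F hF).mono_set hBS
  have : IsFiniteMeasure (volume.restrict B) := ⟨by simpa using hBfin.lt_top⟩
  set k : Plane → ENNReal := S.indicator (fun w => ENNReal.ofReal (‖fderiv ℝ φ w‖ ^ 2)) with hk
  have hkm : Measurable k := hN.measurable.ennreal_ofReal.indicator hS.measurableSet
  set β := (∫ y in B, φ y) / volume.real B with hβ
  refine ⟨β, ?_⟩
  have jensen : ∀ x, volume.real B * (φ x - β) ^ 2 ≤ ∫ y in B, (φ x - φ y) ^ 2 := by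
    intro x
    have h1 := sq_integral_le_mul_integral (μ := volume.restrict B) (u := fun _ => (1 : ℝ))
      (v := fun y => (φ x - φ y) ^ 2) (w := fun y => φ x - φ y) (integrable_const _)
      (hiB _ (by fun_prop)) (hiB _ (by fun_prop)) (by simp)
      (ae_of_all _ fun y => sq_nonneg _) (by simp)
    have h2 : ∫ y in B, (φ x - φ y) = volume.real B * (φ x - β) := by
      rw [integral_sub (integrable_const _) (hiB _ hφc), hβ]
      simp only [integral_const, measureReal_restrict_apply_univ, smul_eq_mul]
      field_simp
    rw [h2] at h1
    simp only [integral_const, measureReal_restrict_apply_univ, smul_eq_mul, mul_one] at h1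
    refine le_of_mul_le_mul_left ?_ hB0
    linarith
  have main : ENNReal.ofReal (volume.real B * ∫ x in S, (φ x - β) ^ 2)
      ≤ ENNReal.ofReal (Metric.diam S ^ 2) * (4 * volume S * ∫⁻ w, k w) := by
    calc ENNReal.ofReal (volume.real B * ∫ x in S, (φ x - β) ^ 2)
        = ∫⁻ x in S, ENNReal.ofReal (volume.real B * (φ x - β) ^ 2) := by
          rw [← integral_const_mul]
          exact ofReal_integral_eq_lintegral_ofReal (hiS _ (by fun_prop))
            (ae_of_all _ fun x => by positivity)
      _ ≤ ∫⁻ x in S, ∫⁻ y in B, ENNReal.ofReal ((φ x - φ y) ^ 2) := by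
          refine lintegral_mono fun x => ?_
          rw [← ofReal_integral_eq_lintegral_ofReal (hiB _ (by fun_prop))
            (ae_of_all _ fun y => sq_nonneg _)]
          exact ENNReal.ofReal_le_ofReal (jensen x)
      _ ≤ ∫⁻ x in S, ∫⁻ y in B, ENNReal.ofReal (Metric.diam S ^ 2) *
            ∫⁻ t in Set.Ioc (0 : ℝ) 1, k (x + t • (y - x)) := by
          refine setLIntegral_mono' hS.measurableSet fun x hx =>
            setLIntegral_mono' hB fun y hy => ?_
          exact sq_sub_le_lintegral_segment hφ
            (Metric.dist_le_diam_of_mem hS.isBounded (hBS hy) hx) (hseg x hx y hy)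
      _ = ENNReal.ofReal (Metric.diam S ^ 2) *
            ∫⁻ x in S, ∫⁻ y in B, ∫⁻ t in Set.Ioc (0 : ℝ) 1, k (x + t • (y - x)) := by
          simp_rw [lintegral_const_mul' _ _ (ENNReal.ofReal_ne_top (r := Metric.diam S ^ 2))]
      _ = ENNReal.ofReal (Metric.diam S ^ 2) *
            ∫⁻ t in Set.Ioc (0 : ℝ) 1, ∫⁻ x in S, ∫⁻ y in B, k (x + t • (y - x)) := by
          congr 1
          have e1 : ∀ x, ∫⁻ y in B, ∫⁻ t in Set.Ioc (0 : ℝ) 1, k (x + t • (y - x))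
              = ∫⁻ t in Set.Ioc (0 : ℝ) 1, ∫⁻ y in B, k (x + t • (y - x)) := fun x => by
            refine lintegral_lintegral_swap (Measurable.aemeasurable ?_)
            refine hkm.comp (Continuous.measurable ?_)
            fun_prop
          simp_rw [e1]
          refine lintegral_lintegral_swap (Measurable.aemeasurable ?_)
          have e2 : Measurable fun q : (Plane × ℝ) × Plane => k (q.1.1 + q.1.2 • (q.2 - q.1.1)) :=
            hkm.comp (Continuous.measurable (by fun_prop))
          exact e2.lintegral_prod_right'
      _ ≤ ENNReal.ofReal (Metric.diam S ^ 2) *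
            ∫⁻ _ in Set.Ioc (0 : ℝ) 1, 4 * volume S * ∫⁻ w, k w := by
          exact mul_le_mul_right (lintegral_mono fun t => lintegral_lintegral_segment_le hBS hkm) _
      _ = _ := by simp
  have hkint : ∫⁻ w, k w = ENNReal.ofReal (∫ x in S, ‖fderiv ℝ φ x‖ ^ 2) := by
    rw [hk, lintegral_indicator hS.measurableSet]
    exact (ofReal_integral_eq_lintegral_ofReal (hiS _ hN) (ae_of_all _ fun x => sq_nonneg _)).symm
  have hI : 0 ≤ ∫ x in S, ‖fderiv ℝ φ x‖ ^ 2 := integral_nonneg fun x => sq_nonneg _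
  have e4 : (4 : ENNReal) * volume S = ENNReal.ofReal (4 * volume.real S) := by
    rw [ENNReal.ofReal_mul (by norm_num), ofReal_measureReal hSfin]
    simp
  rw [hkint, e4, ← ENNReal.ofReal_mul (by positivity), ← ENNReal.ofReal_mul (by positivity)] at main
  exact (ENNReal.ofReal_le_ofReal_iff (by positivity)).1 main

theorem measureReal_plane_ball (c : Plane) {r : ℝ} (hr : 0 ≤ r) :
    volume.real (Metric.ball c r) = r ^ 2 * Real.pi := by
  rw [measureReal_def, EuclideanSpace.volume_ball_fin_two]
  simp [hr, Real.pi_pos.le]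

theorem measureReal_plane_closedBall (c : Plane) {r : ℝ} (hr : 0 ≤ r) :
    volume.real (Metric.closedBall c r) = r ^ 2 * Real.pi := by
  rw [measureReal_def, EuclideanSpace.volume_closedBall_fin_two]
  simp [hr, Real.pi_pos.le]

theorem IsMeshRegular.integral_sub_segMean_sq_le {m : ℕ} [NeZero m] {P : Set Plane}
    {z : Fin m → Plane} {ρ : ℝ} (hρ : 0 < ρ) (hP : IsPolygonalDomain P z)
    (hreg : IsMeshRegular ρ P z) {φ : Plane → ℝ} (hφ : ContDiff ℝ 1 φ) (i : Fin m) :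
    ∫ x in interior P, (φ x - segMean φ (z i) (z (i + 1))) ^ 2
      ≤ (8 / ρ ^ 2 + 4 * Real.pi / ρ ^ 2 * (1 + 8 / ρ ^ 2)) *
        (Metric.diam P ^ 2 * ∫ x in interior P, ‖fderiv ℝ φ x‖ ^ 2) := by
  obtain ⟨⟨c, r, hr, hstar⟩, hedge⟩ := hreg
  have hφc := hφ.continuous
  have hN := continuous_normSq_fderiv hφ
  rw [setIntegral_congr_set hP.ae_eq_interior, setIntegral_congr_set hP.ae_eq_interior]
  set h := Metric.diam P with hh
  set a := segMean φ (z i) (z (i + 1)) with ha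
  have hz := hP.mem
  have hd : ∀ x ∈ P, ∀ y ∈ P, dist x y ≤ h := fun x hx y hy =>
    Metric.dist_le_diam_of_mem hP.isCompact.isBounded hx hy
  have h0 : 0 < h := (dist_pos.2 (hP.node_ne i)).trans_le (hd _ (hz i) _ (hz (i + 1)))
  set s := ρ * h with hs
  have hs0 : 0 < s := mul_pos hρ h0
  have hstar' : ∀ x ∈ Metric.ball c s, StarConvex ℝ x P := fun x hx =>
    hstar x (Metric.ball_subset_ball hr hx)
  have hball : Metric.ball c s ⊆ P := fun x hx => by
    have := hstar' x hx (hz i) zero_le_one le_rfl (by norm_num)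
    simpa using this
  have hcP : c ∈ P := hball (Metric.mem_ball_self hs0)
  have hiP : ∀ F : Plane → ℝ, Continuous F → IntegrableOn F P := fun F hF =>
    hF.continuousOn.integrableOn_compact hP.isCompact
  set T := convexHull ℝ {c, z i, z (i + 1)} with hT
  have hTP : T ⊆ P := by
    rw [hT, convexHull_insert (by simp), convexHull_pair, convexJoin_singleton_left]
    refine Set.iUnion₂_subset fun y hy => ?_
    exact (hstar' c (Metric.mem_ball_self hs0)).segment_subset
      (hP.isCompact.isClosed.frontier_subset (hP.edge_subset i hy))
  have hTc : IsCompact T := isCompact_triangle _ _ _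
  -- Half of base times height: both the edge and the distance from `c` to its line are at least
  -- `s`.
  have ht : s ^ 2 / 2 ≤ volume.real T := by
    have h1 := mul_dist_le_abs_triangleDet hs0 hstar' (hP.node_ne i) (hz i) (hz (i + 1))
      (hP.edge_subset i)
    have h2 := mul_le_mul_of_nonneg_left (hedge i) hs0.le
    rw [hT, measureReal_triangle]
    nlinarith
  have hPvol : volume.real P ≤ h ^ 2 * Real.pi := by
    rw [← measureReal_plane_closedBall c h0.le]
    exact measureReal_mono (fun x hx => hd x hx c hcP)
      (isCompact_closedBall c h).measure_lt_top.ne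
  have hBvol := measureReal_plane_ball c hs0.le
  obtain ⟨β, hβ⟩ := exists_integral_sub_sq_le_of_segment_subset hφ hP.isCompact
    measurableSet_ball hball (by rw [hBvol]; positivity) (fun x hx y hy => by
      rw [segment_symm]; exact (hstar' y hy).segment_subset hx)
  set D := h ^ 2 * ∫ x in P, ‖fderiv ℝ φ x‖ ^ 2 with hD
  have hI0 : 0 ≤ ∫ x in P, ‖fderiv ℝ φ x‖ ^ 2 := integral_nonneg fun x => sq_nonneg _
  have hD0 : 0 ≤ D := mul_nonneg (sq_nonneg _) hI0
  set X := ∫ x in P, (φ x - β) ^ 2 with hX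
  -- The factor is `4 |P| / |B|`, with `P` inside a disc of radius `h` and `B` a disc of radius `ρ
  -- h`.
  have hX1 : X ≤ 4 / ρ ^ 2 * D := by
    rw [hBvol] at hβ
    have h1 : s ^ 2 * Real.pi * X ≤ s ^ 2 * Real.pi * (4 / ρ ^ 2 * D) := by
      calc s ^ 2 * Real.pi * X ≤ h ^ 2 * (4 * volume.real P * ∫ x in P, ‖fderiv ℝ φ x‖ ^ 2) := hβ
        _ = 4 * volume.real P * D := by rw [hD]; ring
        _ ≤ 4 * (h ^ 2 * Real.pi) * D := by gcongr
        _ = s ^ 2 * Real.pi * (4 / ρ ^ 2 * D) := by rw [hs]; field_simp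
    exact le_of_mul_le_mul_left h1 (by positivity)
  have hTa : ∫ x in T, (φ x - a) ^ 2 ≤ 3 / 8 * D := by
    have h1 := triangle_friedrichs hφ (hd _ (hz i) _ hcP) (hd _ (hz (i + 1)) _ hcP)
      (hd _ (hz i) _ (hz (i + 1)))
    refine h1.trans ?_
    rw [hD, mul_assoc]
    refine mul_le_mul_of_nonneg_left (mul_le_mul_of_nonneg_left ?_ (sq_nonneg _)) (by norm_num)
    exact setIntegral_mono_set (hiP _ hN) (ae_of_all _ fun x => sq_nonneg _)
      (LE.le.eventuallyLE hTP)
  have hTβ : ∫ x in T, (φ x - β) ^ 2 ≤ X :=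
    setIntegral_mono_set (hiP _ (by fun_prop)) (ae_of_all _ fun x => sq_nonneg _)
      (LE.le.eventuallyLE hTP)
  have split : ∀ U ⊆ P, MeasurableSet U → ∀ p q r : Plane → ℝ, Continuous p → Continuous q →
      Continuous r → (∀ x, p x ≤ 2 * q x + 2 * r x) →
      ∫ x in U, p x ≤ 2 * (∫ x in U, q x) + 2 * ∫ x in U, r x := by
    intro U hU _ p q r hp hq hr hle
    have i1 := fun F hF => (hiP F hF).mono_set hU
    rw [← integral_const_mul, ← integral_const_mul,
      ← integral_add (i1 _ (by fun_prop)) (i1 _ (by fun_prop))]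
    exact integral_mono (i1 _ hp) (i1 _ (by fun_prop)) hle
  -- On `T` both `a` and `β` approximate `φ`, with errors `3/8 D` and `X`. Doubling gives `3/4 +
  -- 8/ρ²`, rounded up.
  have hdiff : volume.real T * (a - β) ^ 2 ≤ (1 + 8 / ρ ^ 2) * D := by
    have h1 := split T hTP hTc.measurableSet (fun _ => (a - β) ^ 2) (fun x => (φ x - a) ^ 2)
      (fun x => (φ x - β) ^ 2) (by fun_prop) (by fun_prop) (by fun_prop)
      (fun x => by nlinarith [sq_nonneg (φ x - a + (φ x - β))])
    simp only [integral_const, measureReal_restrict_apply_univ, smul_eq_mul] at h1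
    have e : (1 + 8 / ρ ^ 2) * D = D + 2 * (4 / ρ ^ 2 * D) := by ring
    rw [e]
    linarith
  -- The bound on `a - β` passes from `T` to `P` at the cost of the area ratio, at most `2π/ρ²`.
  have hconst : volume.real P * (a - β) ^ 2
      ≤ 2 * Real.pi / ρ ^ 2 * ((1 + 8 / ρ ^ 2) * D) := by
    calc volume.real P * (a - β) ^ 2 ≤ h ^ 2 * Real.pi * (a - β) ^ 2 := by gcongr
      _ = 2 * Real.pi / ρ ^ 2 * (s ^ 2 / 2 * (a - β) ^ 2) := by rw [hs]; field_simp
      _ ≤ 2 * Real.pi / ρ ^ 2 * (volume.real T * (a - β) ^ 2) := by gcongr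
      _ ≤ _ := by gcongr
  have hfin := split P subset_rfl hP.isCompact.measurableSet (fun x => (φ x - a) ^ 2)
    (fun x => (φ x - β) ^ 2) (fun _ => (a - β) ^ 2) (by fun_prop) (by fun_prop) (by fun_prop)
    (fun x => by nlinarith [sq_nonneg (φ x - β + (a - β))])
  simp only [integral_const, measureReal_restrict_apply_univ, smul_eq_mul] at hfin
  calc ∫ x in P, (φ x - a) ^ 2 ≤ 2 * X + 2 * (volume.real P * (a - β) ^ 2) := hfin
    _ ≤ 2 * (4 / ρ ^ 2 * D) + 2 * (2 * Real.pi / ρ ^ 2 * ((1 + 8 / ρ ^ 2) * D)) := by gcongr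
    _ = _ := by ring

end

theorem mainTheorem9 :
    (∀ ρ : ℝ, 0 < ρ → ∃ C : ℝ, 0 < C ∧
      ∀ (m : ℕ) [NeZero m] (P : Set Plane) (z : Fin m → Plane),
        IsPolygonalDomain P z → IsMeshRegular ρ P z → PoincareFriedrichs P z C) ∧
    (∀ (m : ℕ) [NeZero m] (P : Set Plane) (z : Fin m → Plane) (c : Plane),
        IsPolygonalDomain P z → IsSubtriangulation P z c →
          PoincareFriedrichs P z (constPF m (maxArea z c / minArea z c))) := by
  refine ⟨fun ρ hρ => ?_, fun m _ P z c hP hT => poincareFriedrichs_constPF hP hT⟩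
  have hpi := Real.pi_pos
  have hC : 0 < 8 / ρ ^ 2 + 4 * Real.pi / ρ ^ 2 * (1 + 8 / ρ ^ 2) := by positivity
  refine ⟨_, Real.sqrt_pos.2 hC, fun m _ P z hP hreg => ?_⟩
  refine poincareFriedrichs_of_contDiff hP (Real.sqrt_nonneg _) fun φ hφ i => ?_
  rw [mul_pow, Real.sq_sqrt hC.le, mul_assoc]
  exact hreg.integral_sub_segMean_sq_le hρ hP hφ i
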